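/- Let $(X,\Sigma,\mathfrak m)$ be a $\sigma$-finite measure space, let $p,q\in(1,\infty)$ with $\frac1p+\frac1q=1$, and let $\mathbb B$ be a separable (real) Banach space. Let $\mathbf E$ be a Banach $\mathbb B$-bundle over $X$, i.e. a map assigning to each $x\in X$ a closed linear subspace $\mathbf E(x)\subseteq\mathbb B$ such that $\{x:\mathbf E(x)\cap U\neq\varnothing\}\in\Sigma$ for every open $U\subseteq\mathbb B$. Assume that $\mathbf E$ is reflexive, i.e. $\mathbf E(x)$ is a reflexive Banach space for $\mathfrak m$-a.e. $x$. A section of $\mathbf E$ is a strongly measurable map $\bar v\colon X\to\mathbb B$ with $\bar v(x)\in\mathbf E(x)$ for every $x$. Let $\Gamma_p(\mathbf E)$ be the space of $\mathfrak m$-a.e. equivalence classes $v=[\bar v]$ of sections with $\|\bar v(\cdot)\|_{\mathbb B}\in L^p(\mathfrak m)$, with the pointwise norm $|v|:=\|\bar v(\cdot)\|_{\mathbb B}$. Let $\Gamma_0(\mathbf E'_{w^*})$ be the space of all families $\bar\omega=(\bar\omega(x))_{x\in X}$ with $\bar\omega(x)\in\mathbf E(x)'$ such that $x\mapsto\langle\bar\omega(x),\bar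 v(x)\rangle$ is measurable for every section $\bar v$, where $\bar\omega,\bar\eta$ are identified if for every section $\bar v$ one has $\langle\bar\omega(x)-\bar\eta(x),\bar v(x)\rangle=0$ for $\mathfrak m$-a.e. $x$; set $$|\omega|:=\bigvee\big\{\langle\bar\omega(\cdot),\bar v(\cdot)\rangle : \bar v\text{ a section},\ \|\bar v(\cdot)\|_{\mathbb B}\le1\big\}\quad\text{for }\omega=[\bar\omega],\qquad \Gamma_q(\mathbf E'_{w^*}):=\{\omega\in\Gamma_0(\mathbf E'_{w^*}) : |\omega|\in L^q(\mathfrak m)\},$$ where $\bigvee$ denotes the least upper bound with respect to the $\mathfrak m$-a.e. order, and endow $\Gamma_q(\mathbf E'_{w^*})$ with the norm $\||\omega|\|_{L^q(\mathfrak m)}$. Both spaces are $L^\infty(\mathfrak m)$-modules under pointwise multiplication. Let $\Gamma_q(\mathbf E'_{w^*})^*$ be the $L^\infty(\mathfrak m)$-module of all $L^\infty(\mathfrak m)$-linear continuous maps $T\colon\Gamma_q(\mathbf E'_{w^*})\to L^1(\mathfrak m)$, with $|T|:=\bigvee\{T(\omega) : |\omega|\le1\ \mathfrak m\text{-a.e.}\}$.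 An $L^p(\mathfrak m)$-Banach $L^\infty(\mathfrak m)$-module is an $L^\infty(\mathfrak m)$-module $\mathscr M$ with a map $|\cdot|\colon\mathscr M\to L^p(\mathfrak m)$ such that, $\mathfrak m$-a.e., $|v|\ge0$ with equality if and only if $v=0$, $|v+w|\le|v|+|w|$, $|f\cdot v|=|f||v|$ for all $v,w\in\mathscr M$ and $f\in L^\infty(\mathfrak m)$, and such that the norm $\||v|\|_{L^p(\mathfrak m)}$ is complete. Then $\Gamma_p(\mathbf E)$ and $\Gamma_q(\mathbf E'_{w^*})^*$ are $L^p(\mathfrak m)$-Banach $L^\infty(\mathfrak m)$-modules, the formula $$\langle\theta(v),\omega\rangle:=\big[\langle\bar\omega(\cdot),\bar v(\cdot)\rangle\big]\qquad\text{for all }v=[\bar v]\in\Gamma_p(\mathbf E),\ \omega=[\bar\omega]\in\Gamma_q(\mathbf E'_{w^*})$$ gives a well-defined map $\theta\colon\Gamma_p(\mathbf E)\to\Gamma_q(\mathbf E'_{w^*})^*$, and $\theta$ is an isomorphism of $L^p(\mathfrak m)$-Banach $L^\infty(\mathfrak m)$-modules: it is $L^\infty(\mathfrak m)$-linear and bijective,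 and $|\theta(v)|=|v|$ holds $\mathfrak m$-a.e. for every $v\in\Gamma_p(\mathbf E)$. -/

import Mathlib

open MeasureTheory
open scoped ENNReal

noncomputable section

namespace BanachBundles

/-! ### The ring `L^∞(μ)` and its action on Lebesgue–Bochner spaces -/

section Linf

variable {X : Type*} [MeasurableSpace X] {μ : Measure X}

/-- The space `L^∞(μ)`. -/
abbrev Linf (μ : Measure X) := Lp ℝ ∞ μ

/-- `L^∞(μ)` is a ring under a.e. pointwise multiplication. -/
instance instMulLinf : Mul (Linf μ) where
  mul f g := (f • g : Lp ℝ ∞ μ)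

instance instOneLinf : One (Linf μ) where
  one := (memLp_top_const (1 : ℝ)).toLp (fun _ => 1)

theorem coeFn_mul (f g : Linf μ) : ⇑(f * g) =ᵐ[μ] fun x => f x * g x :=
  Lp.coeFn_lpSMul f g

theorem coeFn_one : ⇑(1 : Linf μ) =ᵐ[μ] fun _ => 1 :=
  MemLp.coeFn_toLp _

instance instCommRingLinf : CommRing (Linf μ) where
  __ := (inferInstance : AddCommGroup (Lp ℝ ∞ μ))
  mul_assoc f g h := by
    apply Lp.ext
    filter_upwards [coeFn_mul (f * g) h, coeFn_mul f g, coeFn_mul f (g * h), coeFn_mul g h]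
      with x h1 h2 h3 h4
    rw [h1, h2, h3, h4, mul_assoc]
  one_mul f := by
    apply Lp.ext
    filter_upwards [coeFn_mul 1 f, coeFn_one (μ := μ)] with x h1 h2
    rw [h1, h2, one_mul]
  mul_one f := by
    apply Lp.ext
    filter_upwards [coeFn_mul f 1, coeFn_one (μ := μ)] with x h1 h2
    rw [h1, h2, mul_one]
  left_distrib f g h := by
    apply Lp.ext
    filter_upwards [coeFn_mul f (g + h), coeFn_mul f g, coeFn_mul f h, Lp.coeFn_add g h,
      Lp.coeFn_add (f * g) (f * h)] with x h1 h2 h3 h4 h5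
    rw [h1, h5, h4, Pi.add_apply, Pi.add_apply, h2, h3, mul_add]
  right_distrib f g h := by
    apply Lp.ext
    filter_upwards [coeFn_mul (f + g) h, coeFn_mul f h, coeFn_mul g h, Lp.coeFn_add f g,
      Lp.coeFn_add (f * h) (g * h)] with x h1 h2 h3 h4 h5
    rw [h1, h5, h4, Pi.add_apply, Pi.add_apply, h2, h3, add_mul]
  zero_mul f := by
    apply Lp.ext
    filter_upwards [coeFn_mul 0 f, Lp.coeFn_zero ℝ ∞ μ] with x h1 h2
    rw [h1, h2, Pi.zero_apply, zero_mul]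
  mul_zero f := by
    apply Lp.ext
    filter_upwards [coeFn_mul f 0, Lp.coeFn_zero ℝ ∞ μ] with x h1 h2
    rw [h1, h2, Pi.zero_apply, mul_zero]
  mul_comm f g := by
    apply Lp.ext
    filter_upwards [coeFn_mul f g, coeFn_mul g f] with x h1 h2
    rw [h1, h2, mul_comm]

variable {B : Type*} [NormedAddCommGroup B] [NormedSpace ℝ B] {p : ℝ≥0∞}

/-- `L^p(μ; B)` is an `L^∞(μ)`-module under a.e. pointwise multiplication. -/
instance instModuleLp : Module (Linf μ) (Lp B p μ) where
  smul f v := (f • v : Lp B p μ)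
  one_smul v := by
    apply Lp.ext
    filter_upwards [Lp.coeFn_lpSMul (r := p) (1 : Linf μ) v, coeFn_one (μ := μ)] with x h1 h2
    refine h1.trans ?_
    rw [Pi.smul_apply', h2, one_smul]
  mul_smul f g v := by
    apply Lp.ext
    filter_upwards [Lp.coeFn_lpSMul (r := p) (f * g) v, coeFn_mul f g,
      Lp.coeFn_lpSMul (r := p) g v, Lp.coeFn_lpSMul (r := p) f (g • v : Lp B p μ)]
      with x h1 h2 h3 h4
    refine h1.trans (Eq.trans ?_ h4.symm)
    rw [Pi.smul_apply', Pi.smul_apply', h2, h3, Pi.smul_apply', mul_smul]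
  smul_zero f := Lp.smul_zero B p f
  smul_add f v w := Lp.add_smul f v w
  add_smul f g v := Lp.smul_add f g v
  zero_smul v := Lp.zero_smul ℝ ∞ v

theorem coeFn_smul (f : Linf μ) (v : Lp B p μ) : ⇑(f • v) =ᵐ[μ] fun x => f x • v x :=
  Lp.coeFn_lpSMul f v

instance instContinuousConstSMulLp [Fact (1 ≤ p)] :
    ContinuousConstSMul (Linf μ) (Lp B p μ) where
  continuous_const_smul f := by
    refine (LipschitzWith.of_dist_le_mul (K := ‖f‖₊) fun v w => ?_).continuous
    rw [dist_eq_norm, dist_eq_norm, ← smul_sub]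
    exact Lp.norm_smul_le f (v - w)

end Linf

/-! ### Extended real valued functions and essential suprema -/

section Essup

variable {X : Type*} [MeasurableSpace X] {μ : Measure X}

/-- The inclusion of `L^0(μ)` into the space of classes of extended real valued functions. -/
def toExt (f : X →ₘ[μ] ℝ) : X →ₘ[μ] EReal :=
  AEEqFun.comp Real.toEReal continuous_coe_real_ereal f

theorem coeFn_toExt (f : X →ₘ[μ] ℝ) : ⇑(toExt f) =ᵐ[μ] fun x => (f x : EReal) :=
  AEEqFun.coeFn_comp _ _ f

theorem toExt_le_toExt {f g : X →ₘ[μ] ℝ} : toExt f ≤ toExt g ↔ f ≤ g := by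
  rw [← AEEqFun.coeFn_le, ← AEEqFun.coeFn_le]
  constructor <;> intro h <;>
    filter_upwards [h, coeFn_toExt f, coeFn_toExt g] with x h1 h2 h3
  · rwa [h2, h3, EReal.coe_le_coe_iff] at h1
  · rwa [h2, h3, EReal.coe_le_coe_iff]

theorem toExt_injective : Function.Injective (toExt (μ := μ)) := fun _ _ h =>
  le_antisymm (toExt_le_toExt.1 h.le) (toExt_le_toExt.1 h.ge)

/-- Over a `σ`-finite measure, every family of extended real valued functions has a least upper
bound with respect to the a.e. order. -/
theorem exists_isLUB [SigmaFinite μ] (S : Set (X →ₘ[μ] EReal)) : ∃ g, IsLUB S g := by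
  obtain ⟨ν, hν, hμν, hνμ⟩ := exists_isFiniteMeasure_absolutelyContinuous μ
  let φ : EReal → ℝ≥0∞ := fun t => ((EReal.exp t)⁻¹ + 1)⁻¹
  have hφ1 : ∀ t, φ t ≤ 1 := fun t => by simp [φ]
  have hφm : Measurable φ := (EReal.measurable_exp.inv.add_const 1).inv
  have hφ : StrictMono φ := fun s t h =>
    ENNReal.inv_lt_inv.2 (ENNReal.add_lt_add_right ENNReal.one_ne_top
      (ENNReal.inv_lt_inv.2 (EReal.exp_strictMono h)))
  let s : Set (X →ₘ[μ] EReal) → X → EReal := fun C x => ⨆ c ∈ C, c x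
  have hs : ∀ C : Set (X →ₘ[μ] EReal), C.Countable → Measurable (s C) := fun C hC =>
    Measurable.biSup C hC fun c _ => c.measurable
  let J : Set (X →ₘ[μ] EReal) → ℝ≥0∞ := fun C => ∫⁻ x, φ (s C x) ∂ν
  have hsmono : ∀ {C D : Set (X →ₘ[μ] EReal)}, C ⊆ D → ∀ x, s C x ≤ s D x :=
    fun h x => biSup_mono h
  have hJmono : ∀ {C D : Set (X →ₘ[μ] EReal)}, C ⊆ D → J C ≤ J D := fun h =>
    lintegral_mono fun x => hφ.monotone (hsmono h x)
  let T : Set ℝ≥0∞ := J '' {C | C ⊆ S ∧ C.Countable}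
  obtain ⟨u, -, hu, huT⟩ := exists_seq_tendsto_sSup (S := T)
    ⟨J ∅, ∅, ⟨Set.empty_subset _, Set.countable_empty⟩, rfl⟩ (OrderTop.bddAbove _)
  choose C hC hCu using huT
  let D : Set (X →ₘ[μ] EReal) := ⋃ n, C n
  have hDS : D ⊆ S := Set.iUnion_subset fun n => (hC n).1
  have hDc : D.Countable := Set.countable_iUnion fun n => (hC n).2
  have hDmax : sSup T ≤ J D :=
    le_of_tendsto' hu fun n => hCu n ▸ hJmono (Set.subset_iUnion C n)
  have hDm := hs D hDc
  have hmk : ⇑(AEEqFun.mk (s D) hDm.aestronglyMeasurable : X →ₘ[μ] EReal) =ᵐ[μ] s D :=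
    AEEqFun.coeFn_mk _ _
  refine ⟨AEEqFun.mk (s D) hDm.aestronglyMeasurable, fun f hf => ?_, fun g hg => ?_⟩
  · have hfc : (insert f D).Countable := hDc.insert f
    have hle : J (insert f D) ≤ J D :=
      (le_sSup (show J (insert f D) ∈ T from
        ⟨insert f D, ⟨Set.insert_subset hf hDS, hfc⟩, rfl⟩)).trans hDmax
    have hfin : J D ≠ ∞ := by
      refine ne_top_of_le_ne_top (measure_ne_top ν Set.univ) ?_
      calc J D ≤ ∫⁻ _, 1 ∂ν := lintegral_mono fun x => hφ1 _
        _ = ν Set.univ := by simp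
    have hae : (fun x => φ (s D x)) =ᵐ[ν] fun x => φ (s (insert f D) x) :=
      ae_eq_of_ae_le_of_lintegral_le
        (Filter.Eventually.of_forall fun x => hφ.monotone (hsmono (Set.subset_insert f D) x))
        hfin (hφm.comp (hs _ hfc)).aemeasurable hle
    rw [← AEEqFun.coeFn_le]
    filter_upwards [hμν.ae_le hae, hmk] with x h1 h2
    rw [h2, hφ.injective h1]
    exact le_biSup (fun c : X →ₘ[μ] EReal => c x) (Set.mem_insert f D)
  · rw [← AEEqFun.coeFn_le]
    have : ∀ᵐ x ∂μ, ∀ c ∈ D, c x ≤ g x :=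
      (ae_ball_iff hDc).2 fun c hc => AEEqFun.coeFn_le.2 (hg (hDS hc))
    filter_upwards [this, hmk] with x h1 h2
    rw [h2]
    exact iSup₂_le h1

open Classical in
/-- The least upper bound of a family of (classes of) functions with respect to the a.e. order. -/
def esupr (S : Set (X →ₘ[μ] EReal)) : X →ₘ[μ] EReal :=
  if h : ∃ g, IsLUB S g then h.choose else AEEqFun.const X ⊥

theorem isLUB_esupr [SigmaFinite μ] (S : Set (X →ₘ[μ] EReal)) : IsLUB S (esupr S) := by
  rw [esupr, dif_pos (exists_isLUB S)]
  exact (exists_isLUB S).choose_spec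

theorem exists_toExt_eq {q : ℝ≥0∞} {s : X →ₘ[μ] EReal} {g : Lp ℝ q μ} (h0 : toExt 0 ≤ s)
    (hg : s ≤ toExt (g : X →ₘ[μ] ℝ)) : ∃ k : Lp ℝ q μ, toExt (k : X →ₘ[μ] ℝ) = s := by
  have hm : AEStronglyMeasurable (fun x => (s x).toReal) μ :=
    s.measurable.ereal_toReal.aestronglyMeasurable
  rw [← AEEqFun.coeFn_le] at h0 hg
  have hs : ∀ᵐ x ∂μ, ((s x).toReal : EReal) = s x ∧ 0 ≤ (s x).toReal ∧ (s x).toReal ≤ g x := by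
    filter_upwards [h0, hg, coeFn_toExt (0 : X →ₘ[μ] ℝ), coeFn_toExt (g : X →ₘ[μ] ℝ),
      AEEqFun.coeFn_zero (μ := μ) (β := ℝ)] with x h1 h2 h3 h4 h5
    rw [h3, h5] at h1
    rw [h4] at h2
    have h6 : ((s x).toReal : EReal) = s x := EReal.coe_toReal
      (ne_top_of_le_ne_top (EReal.coe_ne_top _) h2) (ne_bot_of_le_ne_bot (EReal.coe_ne_bot _) h1)
    refine ⟨h6, ?_, ?_⟩
    · rw [← h6] at h1
      exact EReal.coe_le_coe_iff.1 h1
    · rw [← h6] at h2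
      exact EReal.coe_le_coe_iff.1 h2
  have hL : MemLp (fun x => (s x).toReal) q μ := by
    refine (Lp.memLp g).mono hm ?_
    filter_upwards [hs] with x hx
    rw [Real.norm_of_nonneg hx.2.1]
    exact hx.2.2.trans (le_abs_self _)
  refine ⟨hL.toLp _, ?_⟩
  apply AEEqFun.ext
  filter_upwards [hs, coeFn_toExt (hL.toLp _ : X →ₘ[μ] ℝ), hL.coeFn_toLp] with x h1 h2 h3
  rw [h2, h3, h1.1]

end Essup

/-! ### Pointwise norms and `L^p`-Banach `L^∞`-modules -/

section PointwiseNorm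

variable {X : Type*} [MeasurableSpace X]

/-- A map `|·|` from `M` to the classes of extended real valued functions. The axioms of a pointwise
norm are collected in `IsLpBanachModule`. -/
class PointwiseNorm (μ : Measure X) (M : Type*) where
  pnorm : M → X →ₘ[μ] EReal

/-- The norm `‖v‖ = ‖ |v| ‖_{L^p(μ)}`. -/
def moduleNorm (μ : Measure X) (p : ℝ≥0∞) {M : Type*} [PointwiseNorm μ M] (v : M) : ℝ≥0∞ :=
  eLpNorm (fun x => (PointwiseNorm.pnorm (μ := μ) v x).toReal) p μ

theorem moduleNorm_eq {μ : Measure X} {p : ℝ≥0∞} {M : Type*} [PointwiseNorm μ M] {v : M}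
    {g : Lp ℝ p μ} (h : toExt (g : X →ₘ[μ] ℝ) = PointwiseNorm.pnorm v) :
    moduleNorm μ p v = eLpNorm g p μ := by
  refine eLpNorm_congr_ae ?_
  filter_upwards [coeFn_toExt (g : X →ₘ[μ] ℝ)] with x hx
  rw [← h, hx, EReal.toReal_coe]

/-- `M` with its map `|·|` is an `L^p(μ)`-Banach `L^∞(μ)`-module: `|·|` takes values in `L^p(μ)`,
it is a pointwise norm, and the norm `‖ |v| ‖_{L^p(μ)}` is complete. -/
structure IsLpBanachModule (μ : Measure X) (p : ℝ≥0∞) (M : Type*) [AddCommGroup M]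
    [Module (Linf μ) M] [PointwiseNorm μ M] : Prop where
  memLp : ∀ v : M, ∃ g : Lp ℝ p μ, toExt (g : X →ₘ[μ] ℝ) = PointwiseNorm.pnorm v
  nonneg : ∀ v : M, ∀ᵐ x ∂μ, 0 ≤ PointwiseNorm.pnorm (μ := μ) v x
  eq_zero_iff : ∀ v : M, (∀ᵐ x ∂μ, PointwiseNorm.pnorm (μ := μ) v x = 0) ↔ v = 0
  add_le : ∀ v w : M, ∀ᵐ x ∂μ, PointwiseNorm.pnorm (μ := μ) (v + w) x ≤
    PointwiseNorm.pnorm (μ := μ) v x + PointwiseNorm.pnorm (μ := μ) w x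
  smul : ∀ (f : Linf μ) (v : M), ∀ᵐ x ∂μ, PointwiseNorm.pnorm (μ := μ) (f • v) x =
    (|f x| : ℝ) * PointwiseNorm.pnorm (μ := μ) v x
  complete : ∀ u : ℕ → M,
    (∀ ε > 0, ∃ n₀, ∀ m ≥ n₀, ∀ n ≥ n₀, moduleNorm μ p (u m - u n) < ε) →
    ∃ v, Filter.Tendsto (fun n => moduleNorm μ p (u n - v)) Filter.atTop (nhds 0)

/-- The dual `M^*`: the `L^∞(μ)`-linear continuous maps from `M` to `L^1(μ)`. -/
abbrev ModuleDual (μ : Measure X) (M : Type*) [NormedAddCommGroup M] [Module (Linf μ) M] :=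
  M →L[Linf μ] Lp ℝ 1 μ

/-- The pointwise norm of `T ∈ M^*`, the essential supremum of `T v` over all `v` with `|v| ≤ 1`. -/
instance instPointwiseNormModuleDual (μ : Measure X) (M : Type*) [NormedAddCommGroup M]
    [Module (Linf μ) M] [PointwiseNorm μ M] : PointwiseNorm μ (ModuleDual μ M) where
  pnorm T := esupr {g | ∃ v : M, (∀ᵐ x ∂μ, PointwiseNorm.pnorm (μ := μ) v x ≤ 1) ∧
    g = toExt (T v : X →ₘ[μ] ℝ)}

end PointwiseNorm

/-! ### Banach bundles and their sections -/

section Bundle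

/-- A Banach `B`-bundle over `X`: a weakly measurable multivalued map whose values are closed linear
subspaces of `B`. -/
structure BanachBundle (X B : Type*) [MeasurableSpace X] [NormedAddCommGroup B]
    [NormedSpace ℝ B] where
  fiber : X → Submodule ℝ B
  isClosed_fiber : ∀ x, IsClosed (fiber x : Set B)
  weaklyMeasurable : ∀ U : Set B, IsOpen U → MeasurableSet {x | ((fiber x : Set B) ∩ U).Nonempty}

variable {X B : Type*} [MeasurableSpace X] [NormedAddCommGroup B] [NormedSpace ℝ B]

/-- Almost every fiber is reflexive. -/
def BanachBundle.IsReflexive (E : BanachBundle X B) (μ : Measure X) : Prop :=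
  ∀ᵐ x ∂μ, Function.Surjective (NormedSpace.inclusionInDoubleDual ℝ (E.fiber x))

/-- The (everywhere defined) sections of `E`: strongly measurable selectors. For separable `B`, strong
measurability is the same as measurability of `x ↦ ⟨ω, v x⟩` for every `ω ∈ B'`. -/
structure Sec (E : BanachBundle X B) where
  toFun : ∀ x, E.fiber x
  stronglyMeasurable : StronglyMeasurable fun x => (toFun x : B)

variable (E : BanachBundle X B) (μ : Measure X)

/-- `Γ_p(E)`: the elements of `L^p(μ; B)` which are represented by a section of `E`. -/
def LpSec (p : ℝ≥0∞) : Submodule (Linf μ) (Lp B p μ) where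
  carrier := {f | ∃ v : Sec E, f =ᵐ[μ] fun x => (v.toFun x : B)}
  zero_mem' := ⟨⟨fun _ => 0, stronglyMeasurable_const⟩, Lp.coeFn_zero B p μ⟩
  add_mem' := by
    rintro f g ⟨v, hv⟩ ⟨w, hw⟩
    refine ⟨⟨fun x => v.toFun x + w.toFun x, v.stronglyMeasurable.add w.stronglyMeasurable⟩, ?_⟩
    filter_upwards [hv, hw, Lp.coeFn_add f g] with x h1 h2 h3
    rw [h3, Pi.add_apply, h1, h2, Submodule.coe_add]
  smul_mem' := by
    rintro c f ⟨v, hv⟩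
    refine ⟨⟨fun x => c x • v.toFun x, (Lp.stronglyMeasurable c).smul v.stronglyMeasurable⟩, ?_⟩
    filter_upwards [hv, coeFn_smul c f] with x h1 h2
    rw [h2, h1, Submodule.coe_smul]

/-- The pointwise norm `|v| = ‖v(·)‖` on `Γ_p(E)`. -/
instance instPointwiseNormLpSec (p : ℝ≥0∞) : PointwiseNorm μ (LpSec E μ p) where
  pnorm v := toExt (AEEqFun.comp norm continuous_norm ((v : Lp B p μ) : X →ₘ[μ] B))

/-! ### Weakly* measurable sections of the dual bundle -/

/-- The maps `ω` with `ω x ∈ E(x)'` for all `x` such that `x ↦ ⟨ω x, v x⟩` is measurable for all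
sections `v` of `E`. -/
def DualSec : AddSubgroup (∀ x, StrongDual ℝ (E.fiber x)) where
  carrier := {ω | ∀ v : Sec E, Measurable fun x => ω x (v.toFun x)}
  zero_mem' _ := measurable_const
  add_mem' hω hη v := (hω v).add (hη v)
  neg_mem' hω v := (hω v).neg

/-- The `ω` such that, for every section `v` of `E`, `⟨ω x, v x⟩ = 0` for a.e. `x`. -/
def nullDualSec : AddSubgroup (DualSec E) where
  carrier := {ω | ∀ v : Sec E, ∀ᵐ x ∂μ, ω.1 x (v.toFun x) = 0}
  zero_mem' _ := Filter.Eventually.of_forall fun _ => rfl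
  add_mem' hω hη v := by
    filter_upwards [hω v, hη v] with x h1 h2
    exact (congrArg₂ (· + ·) h1 h2).trans (add_zero 0)
  neg_mem' hω v := by
    filter_upwards [hω v] with x h1
    exact (congrArg Neg.neg h1).trans neg_zero

/-- `Γ_0(E'_{w*})`: two maps are identified if their difference is null. -/
def DualSec0 := DualSec E ⧸ nullDualSec E μ

instance instAddCommGroupDualSec0 : AddCommGroup (DualSec0 E μ) :=
  inferInstanceAs (AddCommGroup (DualSec E ⧸ nullDualSec E μ))

variable {E} in
/-- The projection onto the quotient. -/
def DualSec0.mk : DualSec E →+ DualSec0 E μ := QuotientAddGroup.mk' (nullDualSec E μ)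

variable {E μ} in
theorem DualSec0.mk_surjective : Function.Surjective (DualSec0.mk (E := E) μ) :=
  QuotientAddGroup.mk'_surjective _

variable {E} in
/-- The class of `x ↦ ⟨ω x, v x⟩`, as a function of `ω`. -/
def pairDualSec (v : Sec E) : DualSec E →+ (X →ₘ[μ] ℝ) where
  toFun ω := AEEqFun.mk (fun x => ω.1 x (v.toFun x)) (ω.2 v).aestronglyMeasurable
  map_zero' := rfl
  map_add' _ _ := rfl

variable {E μ}

/-- The class of `x ↦ ⟨ω x, v x⟩`, as a function of the class of `ω`. -/
def pair (v : Sec E) : DualSec0 E μ →+ (X →ₘ[μ] ℝ) :=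
  QuotientAddGroup.lift _ (pairDualSec μ v) fun _ hω =>
    AEEqFun.ext (((AEEqFun.coeFn_mk _ _).trans (hω v)).trans AEEqFun.coeFn_zero.symm)

theorem coeFn_pair_mk (v : Sec E) (ω : DualSec E) :
    ⇑(pair v (DualSec0.mk μ ω)) =ᵐ[μ] fun x => ω.1 x (v.toFun x) :=
  AEEqFun.coeFn_mk _ _

theorem DualSec0.ext {ω η : DualSec0 E μ} (h : ∀ v : Sec E, pair v ω = pair v η) : ω = η := by
  rw [← sub_eq_zero]
  have h' : ∀ v : Sec E, pair v (ω - η) = 0 := fun v => by rw [map_sub, h, sub_self]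
  obtain ⟨ζ, hζ⟩ := DualSec0.mk_surjective (ω - η)
  rw [← hζ] at h' ⊢
  refine (QuotientAddGroup.eq_zero_iff ζ).2 fun v => ?_
  filter_upwards [coeFn_pair_mk (μ := μ) v ζ, AEEqFun.coeFn_zero (μ := μ) (β := ℝ)] with x h1 h2
  rw [← h1, h' v, h2, Pi.zero_apply]

/-- `f • ω` is the class of `x ↦ f x • ω x`. -/
instance instSMulDualSec0 : SMul (Linf μ) (DualSec0 E μ) where
  smul f := QuotientAddGroup.map (nullDualSec E μ) (nullDualSec E μ)
    { toFun := fun ω => ⟨fun x => f x • ω.1 x, fun v =>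
        (Lp.stronglyMeasurable f).measurable.mul (ω.2 v)⟩
      map_zero' := Subtype.ext (funext fun _ => smul_zero _)
      map_add' := fun _ _ => Subtype.ext (funext fun _ => smul_add _ _ _) }
    fun _ hω v => by
      filter_upwards [hω v] with x hx
      exact (congrArg (f x * ·) hx).trans (mul_zero _)

theorem coeFn_pair_smul (v : Sec E) (f : Linf μ) (ω : DualSec0 E μ) :
    ⇑(pair v (f • ω)) =ᵐ[μ] fun x => f x * pair v ω x := by
  obtain ⟨ζ, rfl⟩ := DualSec0.mk_surjective ω
  filter_upwards [coeFn_pair_mk (μ := μ) v ζ, coeFn_pair_mk (μ := μ) v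
    ⟨fun x => f x • ζ.1 x, fun v => (Lp.stronglyMeasurable f).measurable.mul (ζ.2 v)⟩] with x h1 h2
  rw [h1]
  exact h2

theorem coeFn_pair_add (v : Sec E) (ω η : DualSec0 E μ) :
    ⇑(pair v (ω + η)) =ᵐ[μ] fun x => pair v ω x + pair v η x := by
  rw [map_add]
  exact AEEqFun.coeFn_add _ _

instance instModuleDualSec0 : Module (Linf μ) (DualSec0 E μ) where
  one_smul ω := DualSec0.ext fun v => AEEqFun.ext <| by
    filter_upwards [coeFn_pair_smul v 1 ω, coeFn_one (μ := μ)] with x h1 h2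
    rw [h1, h2, one_mul]
  mul_smul f g ω := DualSec0.ext fun v => AEEqFun.ext <| by
    filter_upwards [coeFn_pair_smul v (f * g) ω, coeFn_pair_smul v f (g • ω),
      coeFn_pair_smul v g ω, coeFn_mul f g] with x h1 h2 h3 h4
    rw [h1, h2, h3, h4, mul_assoc]
  smul_zero f := map_zero _
  smul_add f ω η := map_add _ _ _
  add_smul f g ω := DualSec0.ext fun v => AEEqFun.ext <| by
    filter_upwards [coeFn_pair_smul v (f + g) ω, coeFn_pair_smul v f ω, coeFn_pair_smul v g ω,
      coeFn_pair_add v (f • ω) (g • ω), Lp.coeFn_add f g] with x h1 h2 h3 h4 h5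
    rw [h1, h4, h2, h3, h5, Pi.add_apply, add_mul]
  zero_smul ω := DualSec0.ext fun v => AEEqFun.ext <| by
    filter_upwards [coeFn_pair_smul v (0 : Linf μ) ω, Lp.coeFn_zero ℝ ∞ μ,
      AEEqFun.coeFn_zero (μ := μ) (β := ℝ)] with x h1 h2 h3
    rw [h1, h2, map_zero, h3, Pi.zero_apply, zero_mul]

/-- The pointwise norm on `Γ_0(E'_{w*})`: the essential supremum of `⟨ω, v⟩` over all sections `v`
with `|v| ≤ 1`. -/
instance instPointwiseNormDualSec0 : PointwiseNorm μ (DualSec0 E μ) where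
  pnorm ω := esupr {g | ∃ v : Sec E, (∀ x, ‖v.toFun x‖ ≤ 1) ∧ g = toExt (pair v ω)}

theorem coeFn_pair_of_eq_mul {u v : Sec E} (c : X → ℝ)
    (h : ∀ x, u.toFun x = c x • v.toFun x) (ω : DualSec0 E μ) :
    ⇑(pair u ω) =ᵐ[μ] fun x => c x * pair v ω x := by
  obtain ⟨ζ, rfl⟩ := DualSec0.mk_surjective ω
  filter_upwards [coeFn_pair_mk (μ := μ) v ζ, coeFn_pair_mk (μ := μ) u ζ] with x h1 h2
  rw [h1, h2, h, map_smul, smul_eq_mul]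

/-- The section `c v`. -/
def Sec.mul (c : X → ℝ) (hc : StronglyMeasurable c) (v : Sec E) : Sec E :=
  ⟨fun x => c x • v.toFun x, hc.smul v.stronglyMeasurable⟩

section SigmaFinite

variable [SigmaFinite μ]

theorem pair_le_pnorm {v : Sec E} (hv : ∀ x, ‖v.toFun x‖ ≤ 1) (ω : DualSec0 E μ) :
    toExt (pair v ω) ≤ PointwiseNorm.pnorm ω :=
  (isLUB_esupr _).1 ⟨v, hv, rfl⟩

theorem pnorm_le {ω : DualSec0 E μ} {g : X →ₘ[μ] EReal}
    (h : ∀ v : Sec E, (∀ x, ‖v.toFun x‖ ≤ 1) → toExt (pair v ω) ≤ g) :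
    PointwiseNorm.pnorm ω ≤ g :=
  (isLUB_esupr _).2 <| by
    rintro _ ⟨v, hv, rfl⟩
    exact h v hv

theorem zero_le_pnorm (ω : DualSec0 E μ) :
    toExt (0 : X →ₘ[μ] ℝ) ≤ PointwiseNorm.pnorm ω := by
  let z : Sec E := ⟨fun _ => 0, stronglyMeasurable_const⟩
  have hz : pair z ω = 0 := AEEqFun.ext <| by
    filter_upwards [coeFn_pair_of_eq_mul (u := z) (v := z) (fun _ => 0) (fun x => by simp [z]) ω,
      AEEqFun.coeFn_zero (μ := μ) (β := ℝ)] with x h1 h2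
    rw [h1, h2, zero_mul, Pi.zero_apply]
  rw [← hz]
  exact pair_le_pnorm (fun x => by simp [z]) ω

theorem abs_pair_le {ω : DualSec0 E μ} {g : X →ₘ[μ] ℝ} (hg : PointwiseNorm.pnorm ω ≤ toExt g)
    {v : Sec E} (hv : ∀ x, ‖v.toFun x‖ ≤ 1) : ∀ᵐ x ∂μ, |pair v ω x| ≤ g x := by
  let w : Sec E := v.mul (fun _ => -1) stronglyMeasurable_const
  have hw : ∀ x, ‖w.toFun x‖ ≤ 1 := fun x => by simpa [w, Sec.mul] using hv x
  have h1 := AEEqFun.coeFn_le.2 (toExt_le_toExt.1 ((pair_le_pnorm hv ω).trans hg))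
  have h2 := AEEqFun.coeFn_le.2 (toExt_le_toExt.1 ((pair_le_pnorm hw ω).trans hg))
  filter_upwards [h1, h2, coeFn_pair_of_eq_mul (u := w) (v := v) (fun _ => -1) (fun _ => rfl) ω]
    with x h1 h2 h3
  rw [h3] at h2
  exact abs_le.2 ⟨by linarith, h1⟩

theorem eq_zero_of_pnorm {ω : DualSec0 E μ} (h : PointwiseNorm.pnorm ω ≤ toExt (0 : X →ₘ[μ] ℝ)) :
    ω = 0 := by
  refine DualSec0.ext fun v => AEEqFun.ext ?_
  have hm : StronglyMeasurable fun x => (1 + ‖v.toFun x‖)⁻¹ :=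
    (measurable_const.add v.stronglyMeasurable.norm.measurable).inv.stronglyMeasurable
  have hpos : ∀ x, 0 < 1 + ‖v.toFun x‖ := fun x => by positivity
  have hu : ∀ x, ‖(v.mul _ hm).toFun x‖ ≤ 1 := fun x => by
    rw [Sec.mul, norm_smul, norm_inv, Real.norm_of_nonneg (hpos x).le, inv_mul_le_one₀ (hpos x)]
    linarith
  filter_upwards [abs_pair_le h hu, coeFn_pair_of_eq_mul (u := v.mul _ hm) (v := v) _
    (fun _ => rfl) ω, AEEqFun.coeFn_zero (μ := μ) (β := ℝ)] with x h1 h2 h3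
  rw [h3, Pi.zero_apply] at h1
  have h4 := abs_nonpos_iff.1 h1
  rw [h2] at h4
  rw [map_zero, h3, Pi.zero_apply]
  exact (mul_eq_zero.1 h4).resolve_left (inv_ne_zero (hpos x).ne')

theorem pnorm_add_le {ω η : DualSec0 E μ} {g h : X →ₘ[μ] ℝ}
    (hg : PointwiseNorm.pnorm ω ≤ toExt g) (hh : PointwiseNorm.pnorm η ≤ toExt h) :
    PointwiseNorm.pnorm (ω + η) ≤ toExt (g + h) := by
  refine pnorm_le fun v hv => toExt_le_toExt.2 ?_
  rw [← AEEqFun.coeFn_le]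
  filter_upwards [abs_pair_le hg hv, abs_pair_le hh hv, coeFn_pair_add v ω η,
    AEEqFun.coeFn_add g h] with x h1 h2 h3 h4
  rw [h3, h4, Pi.add_apply]
  exact add_le_add ((le_abs_self _).trans h1) ((le_abs_self _).trans h2)

theorem pnorm_smul_le {q : ℝ≥0∞} {ω : DualSec0 E μ} {g : Lp ℝ q μ} (f : Linf μ)
    (hg : PointwiseNorm.pnorm ω ≤ toExt (g : X →ₘ[μ] ℝ)) :
    PointwiseNorm.pnorm (f • ω) ≤ toExt ((|f • g| : Lp ℝ q μ) : X →ₘ[μ] ℝ) := by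
  refine pnorm_le fun v hv => toExt_le_toExt.2 ?_
  rw [← AEEqFun.coeFn_le]
  filter_upwards [abs_pair_le hg hv, coeFn_pair_smul v f ω, Lp.coeFn_abs (f • g),
    coeFn_smul f g] with x h1 h2 h3 h4
  rw [h2, h3, h4, smul_eq_mul]
  refine (le_abs_self _).trans ?_
  rw [abs_mul, abs_mul]
  exact mul_le_mul_of_nonneg_left (h1.trans (le_abs_self _)) (abs_nonneg _)

theorem pnorm_neg_le (ω : DualSec0 E μ) :
    PointwiseNorm.pnorm (-ω) ≤ PointwiseNorm.pnorm (μ := μ) ω := by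
  refine pnorm_le fun v hv => ?_
  let w : Sec E := v.mul (fun _ => -1) stronglyMeasurable_const
  have hw : ∀ x, ‖w.toFun x‖ ≤ 1 := fun x => by simpa [w, Sec.mul] using hv x
  have : pair v (-ω) = pair w ω := AEEqFun.ext <| by
    rw [map_neg]
    filter_upwards [coeFn_pair_of_eq_mul (u := w) (v := v) (fun _ => -1) (fun _ => rfl) ω,
      AEEqFun.coeFn_neg (pair v ω)] with x h1 h2
    rw [h1, h2, Pi.neg_apply, neg_one_mul]
  rw [this]
  exact pair_le_pnorm hw ω

variable (E μ) in
/-- `Γ_q(E'_{w*})`: the `ω ∈ Γ_0(E'_{w*})` with `|ω| ∈ L^q(μ)`. -/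
def LqDualSec (q : ℝ≥0∞) : Submodule (Linf μ) (DualSec0 E μ) where
  carrier := {ω | ∃ g : Lp ℝ q μ, toExt (g : X →ₘ[μ] ℝ) = PointwiseNorm.pnorm ω}
  zero_mem' := exists_toExt_eq (g := 0) (zero_le_pnorm (0 : DualSec0 E μ)) <| pnorm_le fun v _ => by
    rw [map_zero]
    exact le_rfl
  add_mem' := by
    rintro ω η ⟨g, hg⟩ ⟨h, hh⟩
    exact exists_toExt_eq (g := g + h) (zero_le_pnorm _) (pnorm_add_le hg.ge hh.ge)
  smul_mem' := by
    rintro f ω ⟨g, hg⟩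
    exact exists_toExt_eq (zero_le_pnorm _) (pnorm_smul_le f hg.ge)

instance instPointwiseNormLqDualSec (q : ℝ≥0∞) : PointwiseNorm μ (LqDualSec E μ q) where
  pnorm ω := PointwiseNorm.pnorm (ω : DualSec0 E μ)

/-- The norm on `Γ_q(E'_{w*})` is `‖ω‖ = ‖ |ω| ‖_{L^q(μ)}`. -/
instance instNormedAddCommGroupLqDualSec (q : ℝ≥0∞) [Fact (1 ≤ q)] :
    NormedAddCommGroup (LqDualSec E μ q) :=
  have key : ∀ (ω : LqDualSec E μ q) (g : Lp ℝ q μ),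
      toExt (g : X →ₘ[μ] ℝ) = PointwiseNorm.pnorm (ω : DualSec0 E μ) →
      (moduleNorm μ q ω).toReal = ‖g‖ := fun ω g h => by
    rw [moduleNorm_eq (v := ω) h, Lp.norm_def]
  have nonneg : ∀ (ω : LqDualSec E μ q) (g : Lp ℝ q μ),
      toExt (g : X →ₘ[μ] ℝ) = PointwiseNorm.pnorm (ω : DualSec0 E μ) →
      ∀ᵐ x ∂μ, 0 ≤ g x := fun ω g h => by
    filter_upwards [AEEqFun.coeFn_le.2 (toExt_le_toExt.1 ((zero_le_pnorm ω.1).trans h.ge)),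
      AEEqFun.coeFn_zero (μ := μ) (β := ℝ)] with x h1 h2
    rwa [h2] at h1
  AddGroupNorm.toNormedAddCommGroup
    { toFun := fun ω => (moduleNorm μ q ω).toReal
      map_zero' := by
        refine (key 0 0 (le_antisymm (zero_le_pnorm 0) ?_)).trans norm_zero
        refine pnorm_le fun v _ => ?_
        rw [ZeroMemClass.coe_zero, map_zero]
        exact le_rfl
      add_le' := fun ω η => by
        obtain ⟨g, hg⟩ := ω.2
        obtain ⟨h, hh⟩ := η.2
        obtain ⟨k, hk⟩ := (ω + η).2
        rw [key _ _ hg, key _ _ hh, key _ _ hk]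
        refine le_trans ?_ (norm_add_le g h)
        refine Lp.norm_le_norm_of_ae_le ?_
        filter_upwards [nonneg _ _ hk, Lp.coeFn_add g h, AEEqFun.coeFn_le.2
          (toExt_le_toExt.1 (hk.le.trans (pnorm_add_le hg.ge hh.ge)))] with x h1 h2 h3
        rw [Real.norm_of_nonneg h1]
        exact h3.trans (le_abs_self _)
      neg' := fun ω => by
        have : PointwiseNorm.pnorm (-ω : DualSec0 E μ) =
            PointwiseNorm.pnorm (μ := μ) (ω : DualSec0 E μ) :=
          le_antisymm (pnorm_neg_le _) (by simpa using pnorm_neg_le (-ω.1))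
        obtain ⟨g, hg⟩ := ω.2
        rw [key _ _ hg, key (-ω) g (hg.trans this.symm)]
      eq_zero_of_map_eq_zero' := fun ω h => by
        obtain ⟨g, hg⟩ := ω.2
        change (moduleNorm μ q ω).toReal = 0 at h
        rw [key _ _ hg, norm_eq_zero] at h
        refine Subtype.ext (eq_zero_of_pnorm ?_)
        rw [← hg, h]
        exact le_rfl }

end SigmaFinite

end Bundle

end BanachBundles

end

open BanachBundles

/-!
The canonical map `θ : Γ_p(E) → Γ_q(E'_{w*})^*` exists by Hölder's inequality. It preserves the
pointwise norm because a separable space `B` has a norming sequence `φ n` of functionals, whose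
restrictions to the fibers, cut off to sets of finite measure, belong to `Γ_q(E'_{w*})`
(`pnorm_toModuleDual`). So `θ` is injective, and since `Γ_p(E)` is closed in `L^p(μ; B)`
(`isLpBanachModule_LpSec`), it remains to prove that `θ` is onto; the module axioms of the dual are
then transported along `θ` (`isLpBanachModule_of_equiv`).

Let `T` be in the dual. On the unit ball `|ω| ≤ 1` the values of `T` are bounded in `L^p`, by the
converse of Hölder's inequality (`lintegral_rpow_le`), and directed upwards, by gluing
(`exists_max`). Hence, for every countable family of `ω`s, there is a single `g` in `L^p` such that
`|T ω| ≤ g |ω|` a.e. (`exists_dominating`). Applied to all integer combinations of a sequence `ω n`,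
this bounds, for a.e. `x`, the assignment `ω n x ↦ T (ω n) x`, which by Hahn–Banach extends to an
element of the bidual of `E(x)` of norm at most `g x`. By reflexivity it is evaluation at a vector
of `E(x)` (`exists_fiberwise_eval`).

For the cut-off functionals `φ n` this produces vectors `v x` of `E(x)`, which depend measurably on
`x` since the `φ n` are norming, and `v` is in `Γ_p(E)`. For an arbitrary `ω`, the same applies to
the family of the `φ n` together with `ω`. As the `φ n` separate points, the resulting vectors are
again `v x`, so `T ω = ⟨ω, v⟩` (`toModuleDual_surjective`). No measurable selection is needed, and
the only functions whose measurability is in doubt, `x ↦ ‖ω x‖`, are replaced by measurable lower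
envelopes (`exists_pnorm_mk_le`).
-/

/-! ### Norming sequences and moment problems -/

/-- A separable normed space is normed by a countable family of functionals of norm at most one. -/
theorem exists_norming_seq (B : Type*) [NormedAddCommGroup B] [NormedSpace ℝ B]
    [TopologicalSpace.SeparableSpace B] :
    ∃ φ : ℕ → StrongDual ℝ B, (∀ n, ‖φ n‖ ≤ 1) ∧ ∀ b r, (∀ n, φ n b ≤ r) → ‖b‖ ≤ r := by
  choose φ hφ hφb using fun n => exists_dual_vector'' ℝ (TopologicalSpace.denseSeq B n)
  refine ⟨φ, hφ, fun b r hr => le_of_forall_pos_le_add fun ε hε => ?_⟩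
  obtain ⟨_, hn, n, rfl⟩ := Metric.dense_iff.1 (TopologicalSpace.denseRange_denseSeq B) b (ε / 2)
    (half_pos hε)
  set c := TopologicalSpace.denseSeq B n with hc
  have h1 : ‖c - b‖ < ε / 2 := by rwa [← dist_eq_norm]
  have h2 : φ n (c - b) ≤ ‖c - b‖ := (le_abs_self _).trans <|
    ((φ n).le_of_opNorm_le (hφ n) _).trans_eq (one_mul _)
  have h3 : φ n c = ‖c‖ := hφb n
  rw [map_sub, h3] at h2
  have h4 : ‖b‖ ≤ ‖c‖ + ‖c - b‖ := by
    simpa [norm_sub_rev] using norm_add_le c (b - c)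
  linarith [hr n]

/-- Pettis' criterion: closed balls are intersections of countably many half spaces, so
measurability may be tested on a norming sequence of functionals. -/
theorem stronglyMeasurable_of_norming {X B : Type*} [MeasurableSpace X] [NormedAddCommGroup B]
    [NormedSpace ℝ B] [TopologicalSpace.SeparableSpace B] {φ : ℕ → StrongDual ℝ B}
    (hφ : ∀ n, ‖φ n‖ ≤ 1) (hφb : ∀ b r, (∀ n, φ n b ≤ r) → ‖b‖ ≤ r) {f : X → B}
    (hf : ∀ n, Measurable fun x => φ n (f x)) : StronglyMeasurable f := by
  borelize B
  have : SecondCountableTopology B := UniformSpace.secondCountable_of_separable B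
  have hd : ∀ b, Measurable fun x => dist b (f x) := fun b => by
    refine measurable_of_Iic fun r => ?_
    have : (fun x => dist b (f x)) ⁻¹' Set.Iic r = ⋂ n, {x | φ n (f x) ≤ r + φ n b} := by
      ext x
      simp only [Set.mem_preimage, Set.mem_Iic, Set.mem_iInter, Set.mem_ofPred_eq]
      rw [dist_comm, dist_eq_norm]
      constructor
      · intro h n
        have h2 : φ n (f x - b) ≤ ‖f x - b‖ := (le_abs_self _).trans <|
          ((φ n).le_of_opNorm_le (hφ n) _).trans_eq (one_mul _)
        rw [map_sub] at h2
        linarith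
      · intro h
        refine hφb _ _ fun n => ?_
        rw [map_sub]
        linarith [h n]
    rw [this]
    exact MeasurableSet.iInter fun n => measurableSet_le (hf n) measurable_const
  refine Measurable.stronglyMeasurable (measurable_of_isOpen fun U hU => ?_)
  have : f ⁻¹' U = ⋃ n : ℕ, ⋃ k : ℕ, ⋃ _ : Metric.ball (TopologicalSpace.denseSeq B n)
      (1 / (k + 1)) ⊆ U, {x | dist (TopologicalSpace.denseSeq B n) (f x) < 1 / (k + 1)} := by
    ext x
    simp only [Set.mem_preimage, Set.mem_iUnion, Set.mem_ofPred_eq]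
    constructor
    · intro hx
      obtain ⟨ε, hε, hU'⟩ := Metric.isOpen_iff.1 hU _ hx
      obtain ⟨k, hk⟩ := exists_nat_one_div_lt (half_pos hε)
      obtain ⟨_, hn, n, rfl⟩ := Metric.dense_iff.1 (TopologicalSpace.denseRange_denseSeq B) (f x)
        (1 / (k + 1)) Nat.one_div_pos_of_nat
      refine ⟨n, k, fun z hz => hU' ?_, hn⟩
      rw [Metric.mem_ball] at hz hn ⊢
      linarith [dist_triangle z (TopologicalSpace.denseSeq B n) (f x)]
    · rintro ⟨n, k, h, hx⟩
      refine h ?_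
      rwa [Metric.mem_ball, dist_comm]
  rw [this]
  exact MeasurableSet.iUnion fun n => MeasurableSet.iUnion fun k => MeasurableSet.iUnion fun _ =>
    measurableSet_lt (hd _) measurable_const

theorem tendsto_floor_mul_div (r : ℝ) :
    Filter.Tendsto (fun k : ℕ => (⌊(k : ℝ) * r⌋ : ℝ) / k) Filter.atTop (nhds r) := by
  have h : Filter.Tendsto (fun k : ℕ => r - Int.fract ((k : ℝ) * r) / k) Filter.atTop
      (nhds (r - 0)) := by
    refine tendsto_const_nhds.sub (squeeze_zero (fun k => ?_) (fun k => ?_)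
      tendsto_one_div_atTop_nhds_zero_nat)
    · exact div_nonneg (Int.fract_nonneg _) (Nat.cast_nonneg k)
    · exact div_le_div_of_nonneg_right (Int.fract_lt_one _).le (Nat.cast_nonneg k)
  rw [sub_zero] at h
  refine h.congr' ?_
  filter_upwards [Filter.eventually_gt_atTop 0] with k hk
  have hk' : (k : ℝ) ≠ 0 := Nat.cast_ne_zero.2 hk.ne'
  rw [Int.fract]
  field_simp
  ring

/-- A bound on integer combinations extends to real combinations, by homogeneity and density. -/
theorem abs_sum_le_of_int {W ι : Type*} [NormedAddCommGroup W] [NormedSpace ℝ W] {η : ι → W}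
    {t : ι → ℝ} {g : ℝ}
    (h : ∀ c : ι →₀ ℤ, |∑ i ∈ c.support, (c i : ℝ) * t i| ≤ g * ‖∑ i ∈ c.support, c i • η i‖)
    (d : ι →₀ ℝ) : |∑ i ∈ d.support, d i * t i| ≤ g * ‖∑ i ∈ d.support, d i • η i‖ := by
  have key : ∀ k : ℕ, 0 < k → |∑ i ∈ d.support, ((⌊(k : ℝ) * d i⌋ : ℝ) / k) * t i| ≤
      g * ‖∑ i ∈ d.support, ((⌊(k : ℝ) * d i⌋ : ℝ) / k) • η i‖ := fun k hk => by
    let c : ι →₀ ℤ := d.mapRange (fun r => ⌊(k : ℝ) * r⌋) (by simp)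
    have hc : c.support ⊆ d.support := Finsupp.support_mapRange
    have hz : ∀ i ∈ d.support, i ∉ c.support → c i = 0 := fun i _ hi =>
      Finsupp.notMem_support_iff.1 hi
    have h1 := h c
    rw [Finset.sum_subset hc fun i h1 h2 => by rw [hz i h1 h2, Int.cast_zero, zero_mul],
      Finset.sum_subset hc fun i h1 h2 => by rw [hz i h1 h2, zero_smul]] at h1
    have hk' : (0 : ℝ) < (k : ℝ)⁻¹ := inv_pos.2 (Nat.cast_pos.2 hk)
    have h2 : ∑ i ∈ d.support, ((⌊(k : ℝ) * d i⌋ : ℝ) / k) * t i =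
        (k : ℝ)⁻¹ * ∑ i ∈ d.support, (c i : ℝ) * t i := by
      rw [Finset.mul_sum]
      refine Finset.sum_congr rfl fun i _ => ?_
      change _ = (k : ℝ)⁻¹ * ((⌊(k : ℝ) * d i⌋ : ℝ) * t i)
      ring
    have h3 : ∑ i ∈ d.support, ((⌊(k : ℝ) * d i⌋ : ℝ) / k) • η i =
        (k : ℝ)⁻¹ • ∑ i ∈ d.support, c i • η i := by
      rw [Finset.smul_sum]
      refine Finset.sum_congr rfl fun i _ => ?_
      change _ = (k : ℝ)⁻¹ • (⌊(k : ℝ) * d i⌋ • η i)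
      rw [← Int.cast_smul_eq_zsmul ℝ, smul_smul]
      congr 1
      ring
    rw [h2, h3, abs_mul, norm_smul, Real.norm_eq_abs, abs_of_pos hk', mul_left_comm]
    exact mul_le_mul_of_nonneg_left h1 hk'.le
  refine le_of_tendsto_of_tendsto
    (tendsto_finsetSum _ fun i _ => (tendsto_floor_mul_div (d i)).mul_const (t i)).abs
    ((tendsto_finsetSum _ fun i _ =>
      (tendsto_floor_mul_div (d i)).smul_const (η i)).norm.const_mul g) ?_
  filter_upwards [Filter.eventually_gt_atTop 0] with k hk
  exact key k hk

/-- A moment problem: prescribed values `t i` at vectors `η i` which are bounded by `g` on integer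
combinations extend to a functional of norm at most `g`, by Hahn–Banach. -/
theorem exists_dual_eq_of_int {W ι : Type*} [NormedAddCommGroup W] [NormedSpace ℝ W] {η : ι → W}
    {t : ι → ℝ} {g : ℝ} (hg : 0 ≤ g)
    (h : ∀ c : ι →₀ ℤ, |∑ i ∈ c.support, (c i : ℝ) * t i| ≤ g * ‖∑ i ∈ c.support, c i • η i‖) :
    ∃ G : StrongDual ℝ W, ‖G‖ ≤ g ∧ ∀ i, G (η i) = t i := by
  let L : (ι →₀ ℝ) →ₗ[ℝ] W := Finsupp.linearCombination ℝ η
  let τ : (ι →₀ ℝ) →ₗ[ℝ] ℝ := Finsupp.linearCombination ℝ t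
  have hL : ∀ d, |τ d| ≤ g * ‖L d‖ := abs_sum_le_of_int h
  have hker : L.ker ≤ τ.ker := fun d hd => by
    have h1 := hL d
    rw [LinearMap.mem_ker.1 hd, norm_zero, mul_zero] at h1
    exact LinearMap.mem_ker.2 (abs_nonpos_iff.1 h1)
  let F : L.range →ₗ[ℝ] ℝ := (L.ker.liftQ τ hker) ∘ₗ (L.quotKerEquivRange.symm : _ →ₗ[ℝ] _)
  have hF : ∀ d, F ⟨L d, d, rfl⟩ = τ d := fun d => by
    have : L.quotKerEquivRange.symm ⟨L d, d, rfl⟩ = L.ker.mkQ d := by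
      rw [LinearEquiv.symm_apply_eq]
      rfl
    change (L.ker.liftQ τ hker) (L.quotKerEquivRange.symm ⟨L d, d, rfl⟩) = τ d
    rw [this]
    exact Submodule.liftQ_apply _ _ _
  have hFb : ∀ w : L.range, ‖F w‖ ≤ g * ‖w‖ := by
    rintro ⟨_, d, rfl⟩
    rw [hF]
    exact hL d
  obtain ⟨G, hG, hGn⟩ := exists_extension_norm_eq L.range (F.mkContinuous g hFb)
  refine ⟨G, hGn.trans_le (LinearMap.mkContinuous_norm_le _ hg _), fun i => ?_⟩
  have hL1 : L (Finsupp.single i 1) = η i := by simp [L]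
  have hτ1 : τ (Finsupp.single i 1) = t i := by simp [τ]
  rw [← hL1, ← hτ1, ← hF]
  exact hG ⟨L (Finsupp.single i 1), _, rfl⟩

/-- In a reflexive space, the functional which solves a moment problem on the dual is evaluation at
a vector. -/
theorem exists_eval_eq_of_reflexive {V ι : Type*} [NormedAddCommGroup V] [NormedSpace ℝ V]
    (hV : Function.Surjective (NormedSpace.inclusionInDoubleDual ℝ V)) {η : ι → StrongDual ℝ V}
    {t : ι → ℝ} {g : ℝ} (hg : 0 ≤ g)
    (h : ∀ c : ι →₀ ℤ, |∑ i ∈ c.support, (c i : ℝ) * t i| ≤ g * ‖∑ i ∈ c.support, c i • η i‖) :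
    ∃ y : V, ‖y‖ ≤ g ∧ ∀ i, η i y = t i := by
  obtain ⟨G, hGn, hG⟩ := exists_dual_eq_of_int hg h
  obtain ⟨y, rfl⟩ := hV G
  have h1 : ‖NormedSpace.inclusionInDoubleDual ℝ V y‖ = ‖y‖ :=
    (NormedSpace.inclusionInDoubleDualLi ℝ (E := V)).norm_map y
  exact ⟨y, h1 ▸ hGn, hG⟩

/-! ### The pointwise norm on weakly* measurable dual sections -/

theorem exists_linf {X : Type*} [MeasurableSpace X] {μ : Measure X} {f : X → ℝ}
    (hf : AEStronglyMeasurable f μ) (C : ℝ) (h : ∀ x, |f x| ≤ C) : ∃ F : Linf μ, F =ᵐ[μ] f := by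
  have hm : MemLp f ∞ μ := memLp_top_of_bound hf C (Filter.Eventually.of_forall h)
  exact ⟨hm.toLp f, hm.coeFn_toLp⟩

section DualBundle

variable {X B : Type*} [MeasurableSpace X] [NormedAddCommGroup B] [NormedSpace ℝ B]
  {E : BanachBundle X B} {μ : Measure X} [SigmaFinite μ] {p q : ℝ≥0∞}

/-- The pointwise norm of the class of `ω` is at most `‖ω x‖`. Since `x ↦ ‖ω x‖` need not be
measurable, it is replaced by a measurable lower envelope, which still dominates every measurable
function below `‖ω x‖`. -/
theorem exists_pnorm_mk_le (ω : DualSec E) :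
    ∃ g : X →ₘ[μ] ℝ, (∀ᵐ x ∂μ, g x ≤ ‖ω.1 x‖) ∧
      PointwiseNorm.pnorm (DualSec0.mk μ ω) ≤ toExt g := by
  obtain ⟨G, hGm, hG, hGi⟩ :=
    exists_measurable_le_forall_setLIntegral_eq μ fun x => ENNReal.ofReal ‖ω.1 x‖
  have hGr : ∀ x, (G x).toReal ≤ ‖ω.1 x‖ := fun x =>
    ENNReal.toReal_le_of_le_ofReal (norm_nonneg (ω.1 x)) (hG x)
  refine ⟨AEEqFun.mk (fun x => (G x).toReal) hGm.ennreal_toReal.aestronglyMeasurable, ?_, ?_⟩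
  · filter_upwards [AEEqFun.coeFn_mk (fun x => (G x).toReal)
      hGm.ennreal_toReal.aestronglyMeasurable (μ := μ)] with x hx
    rw [hx]
    exact hGr x
  · refine pnorm_le fun v hv => toExt_le_toExt.2 (AEEqFun.coeFn_le.1 ?_)
    have h1 : (fun x => ENNReal.ofReal (ω.1 x (v.toFun x))) ≤ᵐ[μ] G := by
      refine ae_le_of_forall_setLIntegral_le_of_sigmaFinite (ω.2 v).ennreal_ofReal fun s _ _ => ?_
      rw [← hGi s]
      refine lintegral_mono fun x => ENNReal.ofReal_le_ofReal ?_
      exact (le_abs_self _).trans (((ω.1 x).le_opNorm _).trans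
        (mul_le_of_le_one_right (norm_nonneg (ω.1 x)) (hv x)))
    filter_upwards [h1, coeFn_pair_mk (μ := μ) v ω, AEEqFun.coeFn_mk (fun x => (G x).toReal)
      hGm.ennreal_toReal.aestronglyMeasurable (μ := μ)] with x h1 h2 h3
    rw [h2, h3]
    exact (ENNReal.ofReal_le_iff_le_toReal (ne_top_of_le_ne_top ENNReal.ofReal_ne_top (hG x))).1 h1

/-- The pointwise norm on `Γ_q(E'_{w*})` as an element of `L^q(μ)`. -/
noncomputable def absDual (ω : LqDualSec E μ q) : Lp ℝ q μ := ω.2.choose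

theorem toExt_absDual (ω : LqDualSec E μ q) :
    toExt (absDual ω : X →ₘ[μ] ℝ) = PointwiseNorm.pnorm ω := ω.2.choose_spec

theorem absDual_nonneg (ω : LqDualSec E μ q) : ∀ᵐ x ∂μ, 0 ≤ absDual ω x := by
  have h := zero_le_pnorm (ω : DualSec0 E μ)
  filter_upwards [AEEqFun.coeFn_le.2 (toExt_le_toExt.1 (h.trans_eq (toExt_absDual ω).symm)),
    AEEqFun.coeFn_zero (μ := μ) (β := ℝ)] with x h1 h2
  rwa [h2] at h1

theorem absDual_le {ω : LqDualSec E μ q} {g : X →ₘ[μ] ℝ}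
    (h : PointwiseNorm.pnorm (ω : DualSec0 E μ) ≤ toExt g) : ∀ᵐ x ∂μ, absDual ω x ≤ g x :=
  AEEqFun.coeFn_le.2 (toExt_le_toExt.1 ((toExt_absDual ω).le.trans h))

theorem absDual_le_norm {ω : LqDualSec E μ q} {ζ : DualSec E} (h : ω.1 = DualSec0.mk μ ζ) :
    ∀ᵐ x ∂μ, absDual ω x ≤ ‖ζ.1 x‖ := by
  obtain ⟨g, hg, hgn⟩ := exists_pnorm_mk_le (μ := μ) ζ
  rw [← h] at hgn
  filter_upwards [hg, absDual_le hgn] with x h1 h2 using h2.trans h1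

theorem absDual_add_le (ω η : LqDualSec E μ q) :
    ∀ᵐ x ∂μ, absDual (ω + η) x ≤ absDual ω x + absDual η x := by
  have h := pnorm_add_le (toExt_absDual ω).ge (toExt_absDual η).ge
  filter_upwards [absDual_le (ω := ω + η) h, Lp.coeFn_add (absDual ω) (absDual η)] with x h1 h2
  exact h1.trans_eq h2

theorem absDual_smul_le (f : Linf μ) (ω : LqDualSec E μ q) :
    ∀ᵐ x ∂μ, absDual (f • ω) x ≤ |f x| * absDual ω x := by
  have h := pnorm_smul_le f (toExt_absDual ω).ge
  filter_upwards [absDual_le (ω := f • ω) h, Lp.coeFn_abs (f • absDual ω),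
    coeFn_smul f (absDual ω), absDual_nonneg ω] with x h1 h2 h3 h4
  refine h1.trans_eq ?_
  rw [h2, h3, smul_eq_mul, abs_mul, abs_of_nonneg h4]

theorem norm_eq_norm_absDual [Fact (1 ≤ q)] (ω : LqDualSec E μ q) : ‖ω‖ = ‖absDual ω‖ := by
  rw [Lp.norm_def, ← moduleNorm_eq (toExt_absDual ω)]
  rfl

theorem pnorm_le_one_iff (ω : LqDualSec E μ q) :
    (∀ᵐ x ∂μ, PointwiseNorm.pnorm (μ := μ) ω x ≤ 1) ↔ ∀ᵐ x ∂μ, absDual ω x ≤ 1 := by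
  have h := coeFn_toExt (absDual ω : X →ₘ[μ] ℝ)
  rw [toExt_absDual] at h
  refine Filter.eventually_congr ?_
  filter_upwards [h] with x hx
  rw [hx]
  exact EReal.coe_le_coe_iff (y := 1)

/-- The pointwise duality estimate `|⟨ω, v⟩| ≤ |ω| |v|` for sections `v` of arbitrary size. -/
theorem abs_pair_le_absDual (v : Sec E) (ω : LqDualSec E μ q) :
    ∀ᵐ x ∂μ, |pair v (ω : DualSec0 E μ) x| ≤ absDual ω x * ‖v.toFun x‖ := by
  have hm : StronglyMeasurable fun x => ‖(v.toFun x : B)‖⁻¹ :=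
    v.stronglyMeasurable.norm.measurable.inv.stronglyMeasurable
  have hw : ∀ x, ‖(v.mul _ hm).toFun x‖ ≤ 1 := fun x => by
    rw [Sec.mul, norm_smul, norm_inv, norm_norm]
    exact inv_mul_le_one
  filter_upwards [abs_pair_le (toExt_absDual ω).ge hw,
    coeFn_pair_of_eq_mul (u := v) (v := v.mul _ hm) (fun x => ‖(v.toFun x : B)‖) (fun x => by
      rcases eq_or_ne (v.toFun x) 0 with h | h
      · simp [Sec.mul, h]
      · have h' : ‖(v.toFun x : B)‖ ≠ 0 := by simpa using h
        rw [Sec.mul, smul_smul, mul_inv_cancel₀ h', one_smul]) ω.1] with x h1 h2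
  rw [h2, abs_mul, abs_norm, mul_comm]
  exact mul_le_mul_of_nonneg_right h1 (norm_nonneg _)

/-- A continuous `L^∞`-linear map is bounded: by continuity at `0` and homogeneity under constant
functions. -/
theorem exists_norm_le [Fact (1 ≤ q)] (T : ModuleDual μ (LqDualSec E μ q)) :
    ∃ C : ℝ, 0 ≤ C ∧ ∀ ω, ‖T ω‖ ≤ C * ‖ω‖ := by
  obtain ⟨δ, hδ, hT⟩ := Metric.continuousAt_iff.1 (T.continuous.continuousAt (x := 0)) 1 one_pos
  refine ⟨δ⁻¹, (inv_pos.2 hδ).le, fun ω => ?_⟩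
  rw [inv_mul_eq_div, le_div_iff₀ hδ, mul_comm]
  refine le_of_forall_gt_imp_ge_of_dense fun R hR => ?_
  have hR0 : 0 < R := (norm_nonneg ω).trans_lt hR
  have hc : 0 < δ / R := div_pos hδ hR0
  obtain ⟨F, hF⟩ := exists_linf (μ := μ) (f := fun _ => δ / R) aestronglyMeasurable_const (δ / R)
    fun _ => (abs_of_pos hc).le
  have h1 : ‖F • ω‖ ≤ δ / R * ‖ω‖ := by
    rw [norm_eq_norm_absDual, norm_eq_norm_absDual]
    refine Lp.norm_le_mul_norm_of_ae_le_mul ?_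
    filter_upwards [absDual_smul_le F ω, absDual_nonneg ω, absDual_nonneg (F • ω), hF]
      with x h1 h2 h3 h4
    rw [Real.norm_of_nonneg h2, Real.norm_of_nonneg h3]
    rwa [h4, abs_of_pos hc] at h1
  have h2 : ‖T (F • ω)‖ = δ / R * ‖T ω‖ := by
    have h3 : T (F • ω) = (δ / R) • T ω := by
      rw [map_smul]
      apply Lp.ext
      filter_upwards [coeFn_smul F (T ω), Lp.coeFn_smul (δ / R) (T ω), hF] with x h1 h2 h3
      rw [h1, h2, h3, Pi.smul_apply]
    rw [h3, norm_smul, Real.norm_of_nonneg hc.le]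
  have h4 : ‖F • ω‖ < δ := h1.trans_lt <| by
    rw [div_mul_eq_mul_div, div_lt_iff₀ hR0]
    exact mul_lt_mul_of_pos_left hR hδ
  have h5 := hT (x := F • ω) (by rwa [dist_zero_right])
  rw [map_zero, dist_zero_right, h2, div_mul_eq_mul_div, div_lt_one hR0] at h5
  exact h5.le

/-- The unit ball `|ω| ≤ 1` is stable under gluing along measurable sets, so the values of `T` on it
are directed upwards. -/
theorem exists_max [Fact (1 ≤ q)] (T : ModuleDual μ (LqDualSec E μ q)) {ζ η : LqDualSec E μ q}
    (hζ : ∀ᵐ x ∂μ, absDual ζ x ≤ 1) (hη : ∀ᵐ x ∂μ, absDual η x ≤ 1) :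
    ∃ ξ : LqDualSec E μ q, (∀ᵐ x ∂μ, absDual ξ x ≤ 1) ∧
      ∀ᵐ x ∂μ, T ξ x = max (T ζ x) |T η x| := by
  have hmζ : Measurable (T ζ) := (Lp.stronglyMeasurable _).measurable
  have hmη : Measurable (T η) := (Lp.stronglyMeasurable _).measurable
  have hA : MeasurableSet {x | |T η x| ≤ T ζ x} := measurableSet_le hmη.abs hmζ
  have hA' : MeasurableSet {x | 0 ≤ T η x} := measurableSet_le measurable_const hmη
  classical
  obtain ⟨F, hF⟩ := exists_linf (μ := μ) (f := fun x => if |T η x| ≤ T ζ x then 1 else 0)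
    (Measurable.ite hA measurable_const measurable_const).aestronglyMeasurable 1
    fun x => by split_ifs <;> simp
  obtain ⟨G, hG⟩ := exists_linf (μ := μ)
    (f := fun x => if |T η x| ≤ T ζ x then 0 else if 0 ≤ T η x then 1 else -1)
    (Measurable.ite hA measurable_const
      (Measurable.ite hA' measurable_const measurable_const)).aestronglyMeasurable 1
    fun x => by split_ifs <;> simp
  -- `G` carries the sign of `T η`, so that `T (G • η) = |T η|` off the set where `F = 1`.
  refine ⟨F • ζ + G • η, ?_, ?_⟩
  · filter_upwards [absDual_add_le (F • ζ) (G • η), absDual_smul_le F ζ, absDual_smul_le G η, hF,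
      hG, hζ, hη] with x h1 h2 h3 h4 h5 h6 h7
    rw [h4] at h2
    rw [h5] at h3
    split_ifs at h2 h3 <;> simp at h2 h3 <;> linarith
  · rw [map_add, map_smul, map_smul]
    filter_upwards [Lp.coeFn_add (F • T ζ) (G • T η), coeFn_smul F (T ζ), coeFn_smul G (T η), hF,
      hG] with x h1 h2 h3 h4 h5
    rw [h1, Pi.add_apply, h2, h3, h4, h5]
    split_ifs with h6 h7
    · simp [max_eq_left h6]
    · rw [max_eq_right (not_le.1 h6).le, abs_of_nonneg h7]
      simp
    · rw [max_eq_right (not_le.1 h6).le, abs_of_neg (not_le.1 h7)]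
      simp

end DualBundle

/-! ### Domination of a functional by a function in `L^p` -/

section Domination

variable {X B : Type*} [MeasurableSpace X] [NormedAddCommGroup B] [NormedSpace ℝ B]
  {E : BanachBundle X B} {μ : Measure X} [SigmaFinite μ] {p q : ℝ≥0∞} [Fact (1 ≤ q)]

/-- The truncated form of `lintegral_rpow_le`. With `w = min (T ξ) k`, testing `T` on `w ^ (p - 1) ξ`
gives `∫ w ^ p ≤ C (∫ w ^ p) ^ (1 / q)`, and the truncation makes `∫ w ^ p` finite. -/
theorem lintegral_truncation_rpow_le [p.HolderConjugate q] (hp₁ : 1 < p) (hp : p < ∞)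
    {T : ModuleDual μ (LqDualSec E μ q)} {C : ℝ} (hC : 0 ≤ C) (hT : ∀ ω, ‖T ω‖ ≤ C * ‖ω‖)
    {ξ : LqDualSec E μ q} (hξ : ∀ᵐ x ∂μ, absDual ξ x ≤ 1) (h0 : ∀ᵐ x ∂μ, 0 ≤ T ξ x) (k : ℕ) :
    ∫⁻ x, ENNReal.ofReal (max 0 (min (T ξ x) k)) ^ p.toReal ∂μ ≤
      ENNReal.ofReal C ^ p.toReal := by
  have hP : 1 < p.toReal := by
    simpa using (ENNReal.toReal_lt_toReal ENNReal.one_ne_top hp.ne).2 hp₁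
  have hPQ : p.toReal.HolderConjugate q.toReal := ENNReal.HolderConjugate.toReal hP
  have hP0 : 0 ≤ p.toReal - 1 := by linarith
  have hq0 : q ≠ 0 := (zero_lt_one.trans_le (Fact.out : 1 ≤ q)).ne'
  have hq : q ≠ ∞ := fun h => by
    have := hPQ.symm.pos
    simp [h] at this
  set w : X → ℝ := fun x => max 0 (min (T ξ x) k) with hw
  have hwm : Measurable w :=
    measurable_const.max ((Lp.stronglyMeasurable (T ξ)).measurable.min measurable_const)
  have hw0 : ∀ x, 0 ≤ w x := fun x => le_max_left _ _
  have hwk : ∀ x, w x ≤ k := fun x => max_le (Nat.cast_nonneg k) (min_le_right _ _)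
  have hwu : ∀ᵐ x ∂μ, w x ≤ T ξ x := by
    filter_upwards [h0] with x hx using max_le hx (min_le_left _ _)
  have hwP : ∀ x, w x ^ p.toReal = w x ^ (p.toReal - 1) * w x := fun x => by
    rcases (hw0 x).eq_or_lt with h | h
    · rw [← h, mul_zero, Real.zero_rpow (by linarith)]
    · rw [← Real.rpow_add_one h.ne', sub_add_cancel]
  have hfm : Measurable fun x => w x ^ (p.toReal - 1) := hwm.pow_const _
  obtain ⟨F, hF⟩ := exists_linf (μ := μ) hfm.aestronglyMeasurable ((k : ℝ) ^ (p.toReal - 1))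
    fun x => by
      rw [abs_of_nonneg (Real.rpow_nonneg (hw0 x) _)]
      exact Real.rpow_le_rpow (hw0 x) (hwk x) hP0
  set I := ∫⁻ x, ENNReal.ofReal (w x) ^ p.toReal ∂μ with hI
  have h1 : I ≤ ENNReal.ofReal ‖T (F • ξ)‖ := by
    rw [ofReal_norm, Lp.enorm_def, eLpNorm_one_eq_lintegral_enorm, map_smul]
    refine lintegral_mono_ae ?_
    filter_upwards [hwu, h0, hF, coeFn_smul F (T ξ)] with x h1 h2 h3 h4
    have h5 := Real.rpow_nonneg (hw0 x) (p.toReal - 1)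
    rw [h4, h3, ENNReal.ofReal_rpow_of_nonneg (hw0 x) (by linarith), hwP, smul_eq_mul,
      Real.enorm_of_nonneg (mul_nonneg h5 h2)]
    exact ENNReal.ofReal_le_ofReal (mul_le_mul_of_nonneg_left h1 h5)
  have h2 : ENNReal.ofReal ‖F • ξ‖ ≤ I ^ (1 / q.toReal) := by
    rw [norm_eq_norm_absDual, ofReal_norm, Lp.enorm_def,
      eLpNorm_eq_lintegral_rpow_enorm_toReal hq0 hq]
    refine ENNReal.rpow_le_rpow (lintegral_mono_ae ?_) (by positivity)
    filter_upwards [hF, absDual_smul_le F ξ, absDual_nonneg (F • ξ), hξ] with x h1 h2 h3 h4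
    have h5 := Real.rpow_nonneg (hw0 x) (p.toReal - 1)
    rw [h1, abs_of_nonneg h5] at h2
    rw [Real.enorm_of_nonneg h3, ← hPQ.sub_one_mul_conj, ENNReal.rpow_mul,
      ENNReal.ofReal_rpow_of_nonneg (hw0 x) hP0]
    exact ENNReal.rpow_le_rpow (ENNReal.ofReal_le_ofReal
      (h2.trans (mul_le_of_le_one_right h5 h4))) hPQ.symm.nonneg
  have hIfin : I ≠ ∞ := by
    have hL1 : ∫⁻ x, ‖T ξ x‖ₑ ∂μ ≠ ∞ := by
      rw [← eLpNorm_one_eq_lintegral_enorm]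
      exact Lp.eLpNorm_ne_top _
    refine ne_top_of_le_ne_top (ENNReal.mul_ne_top (ENNReal.ofReal_ne_top
      (r := (k : ℝ) ^ (p.toReal - 1))) hL1) ?_
    rw [← lintegral_const_mul' _ _ ENNReal.ofReal_ne_top]
    refine lintegral_mono_ae ?_
    filter_upwards [hwu, h0] with x h1 h2
    have h5 := Real.rpow_nonneg (hw0 x) (p.toReal - 1)
    rw [ENNReal.ofReal_rpow_of_nonneg (hw0 x) (by linarith), hwP, Real.enorm_of_nonneg h2,
      ← ENNReal.ofReal_mul (Real.rpow_nonneg (Nat.cast_nonneg k) _)]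
    exact ENNReal.ofReal_le_ofReal (mul_le_mul (Real.rpow_le_rpow (hw0 x) (hwk x) hP0) h1 (hw0 x)
      (Real.rpow_nonneg (Nat.cast_nonneg k) _))
  have h3 : I ≤ ENNReal.ofReal C * I ^ (1 / q.toReal) :=
    h1.trans ((ENNReal.ofReal_le_ofReal (hT _)).trans
      ((ENNReal.ofReal_mul hC).trans_le (mul_le_mul_right h2 _)))
  rcases eq_or_ne I 0 with h | h
  · rw [h]
    exact zero_le
  · have h4 : I ^ (1 / p.toReal) * I ^ (1 / q.toReal) = I := by
      rw [← ENNReal.rpow_add _ _ h hIfin, one_div, one_div, hPQ.inv_add_inv_eq_one,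
        ENNReal.rpow_one]
    have h5 : I ^ (1 / p.toReal) ≤ ENNReal.ofReal C := by
      refine (ENNReal.mul_le_mul_iff_left (c := I ^ (1 / q.toReal)) ?_ ?_).1 (h4.trans_le h3)
      · exact (ENNReal.rpow_pos (pos_iff_ne_zero.2 h) hIfin).ne'
      · exact ENNReal.rpow_ne_top_of_nonneg (by positivity) hIfin
    calc I = (I ^ (1 / p.toReal)) ^ p.toReal := by
          rw [← ENNReal.rpow_mul, one_div_mul_cancel (by linarith), ENNReal.rpow_one]
      _ ≤ _ := ENNReal.rpow_le_rpow h5 (by linarith)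

/-- The converse of Hölder's inequality for a value of `T` on the unit ball `|ω| ≤ 1`. -/
theorem lintegral_rpow_le [p.HolderConjugate q] (hp₁ : 1 < p) (hp : p < ∞)
    {T : ModuleDual μ (LqDualSec E μ q)} {C : ℝ} (hC : 0 ≤ C) (hT : ∀ ω, ‖T ω‖ ≤ C * ‖ω‖)
    {ξ : LqDualSec E μ q} (hξ : ∀ᵐ x ∂μ, absDual ξ x ≤ 1) (h0 : ∀ᵐ x ∂μ, 0 ≤ T ξ x) :
    ∫⁻ x, ENNReal.ofReal (T ξ x) ^ p.toReal ∂μ ≤ ENNReal.ofReal C ^ p.toReal := by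
  have hm : Measurable (T ξ) := (Lp.stronglyMeasurable _).measurable
  refine le_of_tendsto' (lintegral_tendsto_of_tendsto_of_monotone (μ := μ)
    (f := fun (k : ℕ) x => ENNReal.ofReal (max 0 (min (T ξ x) k)) ^ p.toReal)
    (fun k => ?_) ?_ ?_) (lintegral_truncation_rpow_le hp₁ hp hC hT hξ h0)
  · exact ((measurable_const.max (hm.min measurable_const)).ennreal_ofReal.pow_const _).aemeasurable
  · refine Filter.Eventually.of_forall fun x k l hkl => ?_
    exact ENNReal.rpow_le_rpow (ENNReal.ofReal_le_ofReal
      (max_le_max_left _ (min_le_min_left _ (Nat.cast_le.2 hkl)))) ENNReal.toReal_nonneg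
  · filter_upwards [h0] with x hx
    refine tendsto_const_nhds.congr' ?_
    obtain ⟨N, hN⟩ := exists_nat_ge (T ξ x)
    filter_upwards [Filter.eventually_ge_atTop N] with k hk
    rw [min_eq_left (hN.trans (Nat.cast_le.2 hk)), max_eq_right hx]

/-- On a countable subset of the unit ball `|ω| ≤ 1`, the values of `T` are dominated by a function
in `L^p`: the running maxima are again values of `T` on the unit ball, hence bounded in `L^p`, and
they increase to the pointwise supremum. -/
theorem exists_dominating_of_le_one [p.HolderConjugate q] (hp₁ : 1 < p) (hp : p < ∞)
    (T : ModuleDual μ (LqDualSec E μ q)) (ω : ℕ → LqDualSec E μ q)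
    (hω : ∀ n, ∀ᵐ x ∂μ, absDual (ω n) x ≤ 1) :
    ∃ g : Lp ℝ p μ, ∀ᵐ x ∂μ, 0 ≤ g x ∧ ∀ n, |T (ω n) x| ≤ g x := by
  obtain ⟨C, hC, hT⟩ := exists_norm_le T
  have hP : 0 < p.toReal := ENNReal.toReal_pos (zero_lt_one.trans hp₁).ne' hp.ne
  choose! M hM1 hM using fun (ζ : LqDualSec E μ q) (n : ℕ) (hζ : ∀ᵐ x ∂μ, absDual ζ x ≤ 1) =>
    exists_max T hζ (hω n)
  let ξ : ℕ → LqDualSec E μ q := fun n => Nat.rec 0 (fun n ζ => M ζ n) n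
  have hξ : ∀ n, ∀ᵐ x ∂μ, absDual (ξ n) x ≤ 1 := fun n => by
    induction n with
    | zero =>
      have h : PointwiseNorm.pnorm ((0 : LqDualSec E μ q) : DualSec0 E μ) ≤
          toExt (0 : X →ₘ[μ] ℝ) := pnorm_le fun v _ => by
        rw [ZeroMemClass.coe_zero, map_zero]
      filter_upwards [absDual_le h, AEEqFun.coeFn_zero (μ := μ) (β := ℝ)] with x h1 h2
      rw [h2] at h1
      exact h1.trans zero_le_one
    | succ n ih => exact hM1 _ n ih
  have hsucc : ∀ᵐ x ∂μ, ∀ n, T (ξ (n + 1)) x = max (T (ξ n) x) |T (ω n) x| :=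
    ae_all_iff.2 fun n => hM (ξ n) n (hξ n)
  have hzero : ∀ᵐ x ∂μ, T (ξ 0) x = 0 := by
    change ∀ᵐ x ∂μ, T 0 x = 0
    rw [map_zero]
    exact Lp.coeFn_zero ℝ 1 μ
  have hmono : ∀ᵐ x ∂μ, Monotone fun n => T (ξ n) x := by
    filter_upwards [hsucc] with x hx
    exact monotone_nat_of_le_succ fun n => (le_max_left _ _).trans_eq (hx n).symm
  have hpos : ∀ᵐ x ∂μ, ∀ n, 0 ≤ T (ξ n) x := by
    filter_upwards [hmono, hzero] with x h1 h2 n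
    exact h2.symm.le.trans (h1 (Nat.zero_le n))
  let H : X → ℝ≥0∞ := fun x => ⨆ n, ENNReal.ofReal (T (ξ n) x) ^ p.toReal
  have hm : ∀ n, Measurable fun x => ENNReal.ofReal (T (ξ n) x) ^ p.toReal := fun n =>
    (Lp.stronglyMeasurable _).measurable.ennreal_ofReal.pow_const _
  have hHm : Measurable H := Measurable.iSup hm
  have hH : ∫⁻ x, H x ∂μ ≠ ∞ := by
    refine ne_top_of_le_ne_top (ENNReal.rpow_ne_top_of_nonneg hP.le
      (ENNReal.ofReal_ne_top (r := C))) ?_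
    rw [lintegral_iSup' fun n => (hm n).aemeasurable]
    · exact iSup_le fun n => lintegral_rpow_le hp₁ hp hC hT (hξ n) (ae_all_iff.1 hpos n)
    · filter_upwards [hmono] with x hx k l hkl
      exact ENNReal.rpow_le_rpow (ENNReal.ofReal_le_ofReal (hx hkl)) hP.le
  have hgm : Measurable fun x => (H x).toReal ^ (1 / p.toReal) := hHm.ennreal_toReal.pow_const _
  have hg : MemLp (fun x => (H x).toReal ^ (1 / p.toReal)) p μ := by
    refine (integrable_norm_rpow_iff hgm.aestronglyMeasurable (zero_lt_one.trans hp₁).ne'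
      hp.ne).1 ((integrable_toReal_of_lintegral_ne_top hHm.aemeasurable hH).congr ?_)
    refine Filter.Eventually.of_forall fun x => ?_
    change _ = ‖(H x).toReal ^ (1 / p.toReal)‖ ^ p.toReal
    rw [Real.norm_of_nonneg (by positivity), ← Real.rpow_mul ENNReal.toReal_nonneg,
      one_div_mul_cancel hP.ne', Real.rpow_one]
  refine ⟨hg.toLp _, ?_⟩
  filter_upwards [hg.coeFn_toLp, hpos, hsucc, ae_lt_top hHm hH] with x h1 h2 h3 h4
  rw [h1]
  refine ⟨by positivity, fun n => ?_⟩
  have h5 : ENNReal.ofReal (T (ξ (n + 1)) x) ^ p.toReal ≤ H x :=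
    le_iSup (fun n => ENNReal.ofReal (T (ξ n) x) ^ p.toReal) (n + 1)
  have h6 : T (ξ (n + 1)) x ^ p.toReal ≤ (H x).toReal := by
    rw [ENNReal.ofReal_rpow_of_nonneg (h2 (n + 1)) hP.le] at h5
    exact (ENNReal.ofReal_le_iff_le_toReal h4.ne).1 h5
  calc |T (ω n) x| ≤ T (ξ (n + 1)) x := (le_max_right _ _).trans_eq (h3 n).symm
    _ = (T (ξ (n + 1)) x ^ p.toReal) ^ (1 / p.toReal) := by
      rw [← Real.rpow_mul (h2 (n + 1)), mul_one_div_cancel hP.ne', Real.rpow_one]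
    _ ≤ _ := Real.rpow_le_rpow (Real.rpow_nonneg (h2 (n + 1)) _) h6 (by positivity)

/-- On a countable family, `T` is pointwise bounded by a function in `L^p`. The normalization
`ω / |ω|` is not available, as `1 / |ω|` may be unbounded, and is replaced by
`ω / max |ω| (1 / (k + 1))`. -/
theorem exists_dominating [p.HolderConjugate q] (hp₁ : 1 < p) (hp : p < ∞)
    (T : ModuleDual μ (LqDualSec E μ q)) {ι : Type*} [Countable ι] [Nonempty ι]
    (ζ : ι → LqDualSec E μ q) :
    ∃ g : Lp ℝ p μ, ∀ᵐ x ∂μ, 0 ≤ g x ∧ ∀ i, |T (ζ i) x| ≤ g x * absDual (ζ i) x := by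
  have hk0 : ∀ k : ℕ, (0 : ℝ) < 1 / (k + 1) := fun k => Nat.one_div_pos_of_nat
  have hmax : ∀ (a : ℝ) (k : ℕ), 0 < max a (1 / (k + 1)) := fun a k =>
    (hk0 k).trans_le (le_max_right _ _)
  choose F hF using fun a : ι × ℕ => exists_linf (μ := μ)
    (f := fun x => (max (absDual (ζ a.1) x) (1 / (a.2 + 1)))⁻¹)
    ((Lp.stronglyMeasurable _).measurable.max measurable_const).inv.aestronglyMeasurable
    (1 / (a.2 + 1))⁻¹ fun x => by
      rw [abs_of_pos (inv_pos.2 (hmax _ _))]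
      exact inv_anti₀ (hk0 _) (le_max_right _ _)
  obtain ⟨e, he⟩ := exists_surjective_nat (ι × ℕ)
  obtain ⟨g, hg⟩ := exists_dominating_of_le_one hp₁ hp T (fun n => F (e n) • ζ (e n).1) fun n => by
    filter_upwards [absDual_smul_le (F (e n)) (ζ (e n).1), hF (e n)] with x h1 h2
    rw [h2, abs_of_pos (inv_pos.2 (hmax _ _)), inv_mul_eq_div] at h1
    exact h1.trans ((div_le_one (hmax _ _)).2 (le_max_left _ _))
  have hs : ∀ᵐ x ∂μ, ∀ a : ι × ℕ, F a x = (max (absDual (ζ a.1) x) (1 / (a.2 + 1)))⁻¹ ∧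
      T (F a • ζ a.1) x = F a x * T (ζ a.1) x := ae_all_iff.2 fun a => by
    rw [map_smul]
    filter_upwards [hF a, coeFn_smul (F a) (T (ζ a.1))] with x h1 h2 using ⟨h1, h2⟩
  refine ⟨g, ?_⟩
  filter_upwards [hg, hs, ae_all_iff.2 fun i => absDual_nonneg (ζ i)] with x h1 h2 h3
  refine ⟨h1.1, fun i => ?_⟩
  have h4 : ∀ k : ℕ, |T (ζ i) x| ≤ g x * max (absDual (ζ i) x) (1 / (k + 1)) := fun k => by
    obtain ⟨n, hn⟩ := he (i, k)
    have h5 := h1.2 n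
    rw [hn, (h2 (i, k)).2, (h2 (i, k)).1, abs_mul, abs_of_pos (inv_pos.2 (hmax _ _)),
      inv_mul_le_iff₀ (hmax _ _)] at h5
    rwa [mul_comm]
  have h5 : Filter.Tendsto (fun k : ℕ => g x * max (absDual (ζ i) x) (1 / ((k : ℝ) + 1)))
      Filter.atTop (nhds (g x * max (absDual (ζ i) x) 0)) :=
    (tendsto_const_nhds.max tendsto_one_div_add_atTop_nhds_zero_nat).const_mul _
  rw [max_eq_left (h3 i)] at h5
  exact ge_of_tendsto' h5 h4

end Domination

/-! ### The module of sections and the canonical map into the dual -/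

section SectionModule

variable {X B : Type*} [MeasurableSpace X] [NormedAddCommGroup B] [NormedSpace ℝ B]
  {E : BanachBundle X B} {μ : Measure X} {p q : ℝ≥0∞}

theorem mem_LpSec_iff {f : Lp B p μ} : f ∈ LpSec E μ p ↔ ∀ᵐ x ∂μ, f x ∈ E.fiber x := by
  constructor
  · rintro ⟨v, hv⟩
    filter_upwards [hv] with x hx
    rw [hx]
    exact (v.toFun x).2
  · intro h
    obtain ⟨t, ht, htm, htf⟩ := h.exists_measurable_mem
    have hmem : ∀ x, t.indicator f x ∈ E.fiber x := fun x => by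
      by_cases hx : x ∈ t
      · rw [Set.indicator_of_mem hx]
        exact htf x hx
      · rw [Set.indicator_of_notMem hx]
        exact zero_mem _
    refine ⟨⟨fun x => ⟨t.indicator f x, hmem x⟩, (Lp.stronglyMeasurable f).indicator htm⟩, ?_⟩
    filter_upwards [ht] with x hx
    exact (Set.indicator_of_mem hx _).symm

theorem coeFn_pnorm_LpSec (v : LpSec E μ p) :
    ⇑(PointwiseNorm.pnorm v : X →ₘ[μ] EReal) =ᵐ[μ] fun x => ((‖v.1 x‖ : ℝ) : EReal) := by
  filter_upwards [coeFn_toExt (AEEqFun.comp norm continuous_norm ((v : Lp B p μ) : X →ₘ[μ] B)),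
    AEEqFun.coeFn_comp norm continuous_norm ((v : Lp B p μ) : X →ₘ[μ] B)] with x h1 h2
  rw [h2] at h1
  exact h1

theorem moduleNorm_LpSec (v : LpSec E μ p) : moduleNorm μ p v = ‖(v : Lp B p μ)‖ₑ := by
  rw [Lp.enorm_def, moduleNorm, ← eLpNorm_norm (v.1 : X → B)]
  refine eLpNorm_congr_ae ?_
  filter_upwards [coeFn_pnorm_LpSec v] with x hx
  rw [hx, EReal.toReal_coe]

/-- `Γ_p(E)` is a closed subspace of `L^p(μ; B)`, hence complete. -/
theorem isLpBanachModule_LpSec [Fact (1 ≤ p)] [CompleteSpace B] :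
    IsLpBanachModule μ p (LpSec E μ p) where
  memLp v := by
    have hm := (Lp.memLp v.1).norm
    refine ⟨hm.toLp _, AEEqFun.ext ?_⟩
    filter_upwards [coeFn_toExt (hm.toLp _ : X →ₘ[μ] ℝ), hm.coeFn_toLp, coeFn_pnorm_LpSec v]
      with x h1 h2 h3
    rw [h1, h2, h3]
  nonneg v := by
    filter_upwards [coeFn_pnorm_LpSec v] with x hx
    rw [hx]
    exact EReal.coe_nonneg.2 (norm_nonneg _)
  eq_zero_iff v := by
    rw [← Submodule.coe_eq_zero, Lp.eq_zero_iff_ae_eq_zero]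
    refine Filter.eventually_congr ?_
    filter_upwards [coeFn_pnorm_LpSec v] with x hx
    rw [hx, EReal.coe_eq_zero, norm_eq_zero, Pi.zero_apply]
  add_le v w := by
    filter_upwards [coeFn_pnorm_LpSec v, coeFn_pnorm_LpSec w, coeFn_pnorm_LpSec (v + w),
      Lp.coeFn_add v.1 w.1] with x h1 h2 h3 h4
    rw [h1, h2, h3, ← EReal.coe_add, EReal.coe_le_coe_iff, Submodule.coe_add, h4]
    exact norm_add_le _ _
  smul f v := by
    filter_upwards [coeFn_pnorm_LpSec v, coeFn_pnorm_LpSec (f • v), coeFn_smul f v.1]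
      with x h1 h2 h3
    rw [h1, h2, ← EReal.coe_mul, Submodule.coe_smul, h3, norm_smul, Real.norm_eq_abs]
  complete u hu := by
    have hc : CauchySeq fun n => (u n : Lp B p μ) := EMetric.cauchySeq_iff.2 fun ε hε => by
      obtain ⟨n₀, h⟩ := hu ε hε
      refine ⟨n₀, fun m hm n hn => ?_⟩
      rw [edist_eq_enorm_sub]
      have h1 := h m hm n hn
      rwa [moduleNorm_LpSec] at h1
    obtain ⟨f, hf⟩ := cauchySeq_tendsto_of_complete hc
    have hmem : f ∈ LpSec E μ p := by
      obtain ⟨φ, -, hφ⟩ := (tendstoInMeasure_of_tendsto_Lp hf).exists_seq_tendsto_ae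
      rw [mem_LpSec_iff]
      filter_upwards [hφ, ae_all_iff.2 fun n => mem_LpSec_iff.1 (u (φ n)).2] with x h1 h2
      exact (E.isClosed_fiber x).mem_of_tendsto h1 (Filter.Eventually.of_forall h2)
    refine ⟨⟨f, hmem⟩, ?_⟩
    refine (tendsto_iff_edist_tendsto_0.1 hf).congr fun n => ?_
    rw [moduleNorm_LpSec, edist_eq_enorm_sub]
    rfl

/-- The structure of an `L^p`-Banach `L^∞`-module is transported along linear isomorphisms which
preserve the pointwise norm. -/
theorem isLpBanachModule_of_equiv {M N : Type*} [AddCommGroup M] [Module (Linf μ) M]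
    [PointwiseNorm μ M] [AddCommGroup N] [Module (Linf μ) N] [PointwiseNorm μ N]
    (hM : IsLpBanachModule μ p M) (e : M ≃ₗ[Linf μ] N)
    (he : ∀ v, PointwiseNorm.pnorm (μ := μ) (e v) = PointwiseNorm.pnorm (μ := μ) v) :
    IsLpBanachModule μ p N := by
  have he' : ∀ w, PointwiseNorm.pnorm (μ := μ) w = PointwiseNorm.pnorm (μ := μ) (e.symm w) :=
    fun w => by rw [← he, e.apply_symm_apply]
  have hn : ∀ w, moduleNorm μ p w = moduleNorm μ p (e.symm w) := fun w => by
    rw [moduleNorm, he', moduleNorm]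
  constructor
  · intro w
    rw [he']
    exact hM.memLp _
  · intro w
    rw [he']
    exact hM.nonneg _
  · intro w
    rw [he', hM.eq_zero_iff, e.symm.map_eq_zero_iff]
  · intro v w
    rw [he', he' v, he' w, map_add]
    exact hM.add_le _ _
  · intro f w
    rw [he', he' w, map_smul]
    exact hM.smul _ _
  · intro u hu
    obtain ⟨v, hv⟩ := hM.complete (fun n => e.symm (u n)) fun ε hε => by
      obtain ⟨n₀, h⟩ := hu ε hε
      refine ⟨n₀, fun m hm n hn' => ?_⟩
      rw [← map_sub, ← hn]
      exact h m hm n hn'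
    refine ⟨e v, hv.congr fun n => ?_⟩
    rw [hn, map_sub, e.symm_apply_apply]

end SectionModule

section Pairing

variable {X B : Type*} [MeasurableSpace X] [NormedAddCommGroup B] [NormedSpace ℝ B]
  {E : BanachBundle X B} {μ : Measure X} [SigmaFinite μ] {p q : ℝ≥0∞}

/-- Hölder's inequality for the pairing of a section in `L^p` with a dual section in `L^q`. -/
theorem eLpNorm_pair_le [p.HolderConjugate q] {v : Lp B p μ} {v' : Sec E}
    (hv : v =ᵐ[μ] fun x => (v'.toFun x : B)) (ω : LqDualSec E μ q) :
    eLpNorm (pair v' (ω : DualSec0 E μ)) 1 μ ≤ eLpNorm (absDual ω) q μ * eLpNorm v p μ := by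
  have : q.HolderConjugate p := ENNReal.HolderConjugate.symm
  refine le_trans ?_ (eLpNorm_smul_le_mul_eLpNorm (p := q) (q := p) (r := 1)
    (Lp.aestronglyMeasurable v) (Lp.aestronglyMeasurable (absDual ω)))
  refine eLpNorm_mono_ae ?_
  filter_upwards [abs_pair_le_absDual v' ω, absDual_nonneg ω, hv] with x h1 h2 h3
  rw [Pi.smul_apply', norm_smul, Real.norm_of_nonneg h2, h3]
  exact h1

/-- Every element of `Γ_p(E)` acts on `Γ_q(E'_{w*})` by the pointwise duality. -/
theorem exists_pairing [Fact (1 ≤ q)] [p.HolderConjugate q] (v : LpSec E μ p) :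
    ∃ S : ModuleDual μ (LqDualSec E μ q), ∀ (v' : Sec E) (ω : LqDualSec E μ q) (ω' : DualSec E),
      (v.1 =ᵐ[μ] fun x => (v'.toFun x : B)) → ω.1 = DualSec0.mk μ ω' →
        S ω =ᵐ[μ] fun x => ω'.1 x (v'.toFun x) := by
  obtain ⟨w, hw⟩ := v.2
  let A : LqDualSec E μ q →+ Lp ℝ 1 μ :=
    { toFun := fun ω => ⟨pair w ω.1, Lp.mem_Lp_iff_eLpNorm_lt_top.2 <|
        (eLpNorm_pair_le hw ω).trans_lt (ENNReal.mul_lt_top (Lp.eLpNorm_lt_top _)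
          (Lp.eLpNorm_lt_top _))⟩
      map_zero' := Subtype.ext (map_zero (pair w))
      map_add' := fun ω η => Subtype.ext (map_add (pair w) ω.1 η.1) }
  have hA : ∀ ω, ‖A ω‖ ≤ ‖(v : Lp B p μ)‖ * ‖ω‖ := fun ω => by
    rw [norm_eq_norm_absDual, mul_comm, Lp.norm_def, Lp.norm_def, Lp.norm_def,
      ← ENNReal.toReal_mul]
    exact ENNReal.toReal_mono (ENNReal.mul_ne_top (Lp.eLpNorm_ne_top _) (Lp.eLpNorm_ne_top _))
      (eLpNorm_pair_le hw ω)
  refine ⟨{ toFun := A, map_add' := A.map_add, map_smul' := fun f ω => Lp.ext ?_,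
            cont := AddMonoidHomClass.continuous_of_bound A _ hA }, fun v' ω ω' hv hω => ?_⟩
  · filter_upwards [coeFn_pair_smul w f ω.1, coeFn_smul f (A ω)] with x h1 h2
    exact h1.trans h2.symm
  · have h1 := coeFn_pair_mk (μ := μ) w ω'
    rw [← hω] at h1
    filter_upwards [h1, hw, hv] with x h1 h2 h3
    have h4 : w.toFun x = v'.toFun x := Subtype.ext (h2.symm.trans h3)
    rw [← h4]
    exact h1

/-- The canonical map from `Γ_p(E)` to the dual of `Γ_q(E'_{w*})`. -/
noncomputable def toModuleDual (E : BanachBundle X B) (μ : Measure X) [SigmaFinite μ]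
    (p q : ℝ≥0∞) [Fact (1 ≤ q)] [p.HolderConjugate q] :
    LpSec E μ p →ₗ[Linf μ] ModuleDual μ (LqDualSec E μ q) where
  toFun v := (exists_pairing v).choose
  map_add' v w := ContinuousLinearMap.ext fun ω => Lp.ext <| by
    obtain ⟨v', hv⟩ := v.2
    obtain ⟨w', hw⟩ := w.2
    obtain ⟨ω', hω⟩ := DualSec0.mk_surjective ω.1
    let s : Sec E := ⟨fun x => v'.toFun x + w'.toFun x,
      v'.stronglyMeasurable.add w'.stronglyMeasurable⟩
    have hs : (v + w).1 =ᵐ[μ] fun x => (s.toFun x : B) := by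
      filter_upwards [hv, hw, Lp.coeFn_add v.1 w.1] with x h1 h2 h3
      exact h3.trans (congrArg₂ (· + ·) h1 h2)
    rw [add_apply]
    filter_upwards [(exists_pairing (q := q) v).choose_spec v' ω ω' hv hω.symm,
      (exists_pairing (q := q) w).choose_spec w' ω ω' hw hω.symm,
      (exists_pairing (q := q) (v + w)).choose_spec s ω ω' hs hω.symm,
      Lp.coeFn_add ((exists_pairing (q := q) v).choose ω) ((exists_pairing (q := q) w).choose ω)]
      with x h1 h2 h3 h4
    rw [h3, h4, Pi.add_apply, h1, h2, ← map_add]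
  map_smul' f v := ContinuousLinearMap.ext fun ω => Lp.ext <| by
    obtain ⟨v', hv⟩ := v.2
    obtain ⟨ω', hω⟩ := DualSec0.mk_surjective ω.1
    have hs : (f • v).1 =ᵐ[μ] fun x => ((v'.mul f (Lp.stronglyMeasurable f)).toFun x : B) := by
      filter_upwards [hv, coeFn_smul f v.1] with x h1 h2
      exact h2.trans (congrArg (f x • ·) h1)
    rw [RingHom.id_apply, smul_apply]
    filter_upwards [(exists_pairing (q := q) v).choose_spec v' ω ω' hv hω.symm,
      (exists_pairing (q := q) (f • v)).choose_spec _ ω ω' hs hω.symm,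
      coeFn_smul f ((exists_pairing (q := q) v).choose ω)] with x h1 h2 h3
    rw [h2, h3, h1, ← map_smul]
    rfl

theorem toModuleDual_apply [Fact (1 ≤ q)] [p.HolderConjugate q] (v : LpSec E μ p) (v' : Sec E)
    (ω : LqDualSec E μ q) (ω' : DualSec E) (hv : v.1 =ᵐ[μ] fun x => (v'.toFun x : B))
    (hω : ω.1 = DualSec0.mk μ ω') :
    toModuleDual E μ p q v ω =ᵐ[μ] fun x => ω'.1 x (v'.toFun x) :=
  (exists_pairing v).choose_spec v' ω ω' hv hω

/-- The restriction of a functional `φ` on the ambient space to the fibers over `S`, extended by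
zero. -/
noncomputable def cutoffDual (E : BanachBundle X B) (φ : StrongDual ℝ B) {S : Set X}
    (hS : MeasurableSet S) : DualSec E :=
  ⟨fun x => S.indicator (fun _ => (1 : ℝ)) x • φ.comp (E.fiber x).subtypeL, fun v =>
    (measurable_const.indicator hS).mul
      (φ.continuous.comp_stronglyMeasurable v.stronglyMeasurable).measurable⟩

theorem cutoffDual_apply (φ : StrongDual ℝ B) {S : Set X} (hS : MeasurableSet S) (x : X)
    (y : E.fiber x) : (cutoffDual E φ hS).1 x y = S.indicator (fun _ => (1 : ℝ)) x * φ y := rfl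

theorem norm_cutoffDual_le {φ : StrongDual ℝ B} (hφ : ‖φ‖ ≤ 1) {S : Set X} (hS : MeasurableSet S)
    (x : X) : ‖(cutoffDual E φ hS).1 x‖ ≤ S.indicator (fun _ => (1 : ℝ)) x := by
  have h0 : 0 ≤ S.indicator (fun _ => (1 : ℝ)) x := Set.indicator_nonneg (fun _ _ => zero_le_one) x
  refine ContinuousLinearMap.opNorm_le_bound _ h0 fun y => ?_
  rw [cutoffDual_apply, norm_mul, Real.norm_of_nonneg h0]
  exact mul_le_mul_of_nonneg_left ((φ.le_of_opNorm_le hφ _).trans_eq (one_mul _)) h0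

theorem exists_cutoffDual {φ : StrongDual ℝ B} (hφ : ‖φ‖ ≤ 1) {S : Set X} (hS : MeasurableSet S)
    (hμ : μ S ≠ ∞) : ∃ ω : LqDualSec E μ q, ω.1 = DualSec0.mk μ (cutoffDual E φ hS) := by
  have hm : MemLp (S.indicator fun _ => (1 : ℝ)) q μ := memLp_indicator_const q hS 1 (Or.inr hμ)
  obtain ⟨g, hg, hgn⟩ := exists_pnorm_mk_le (μ := μ) (cutoffDual E φ hS)
  refine ⟨⟨_, exists_toExt_eq (g := hm.toLp _) (zero_le_pnorm _)
    (hgn.trans (toExt_le_toExt.2 (AEEqFun.coeFn_le.1 ?_)))⟩, rfl⟩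
  filter_upwards [hg, hm.coeFn_toLp] with x h1 h2
  exact (h1.trans (norm_cutoffDual_le hφ hS x)).trans_eq h2.symm

/-- The canonical map preserves the pointwise norm: a norming sequence of functionals on the ambient
space, cut off to sets of finite measure, norms the elements of `Γ_p(E)`. -/
theorem pnorm_toModuleDual [TopologicalSpace.SeparableSpace B] [Fact (1 ≤ q)]
    [p.HolderConjugate q] (v : LpSec E μ p) :
    PointwiseNorm.pnorm (μ := μ) (toModuleDual E μ p q v) = PointwiseNorm.pnorm (μ := μ) v := by
  obtain ⟨v', hv⟩ := v.2
  have hlub := isLUB_esupr (μ := μ) {g | ∃ ω : LqDualSec E μ q,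
    (∀ᵐ x ∂μ, PointwiseNorm.pnorm (μ := μ) ω x ≤ 1) ∧
      g = toExt (toModuleDual E μ p q v ω : X →ₘ[μ] ℝ)}
  refine le_antisymm (hlub.2 ?_) ?_
  · rintro _ ⟨ω, hω, rfl⟩
    rw [← AEEqFun.coeFn_le]
    obtain ⟨ω', hω'⟩ := DualSec0.mk_surjective ω.1
    have h0 := coeFn_pair_mk (μ := μ) v' ω'
    rw [hω'] at h0
    filter_upwards [coeFn_toExt (toModuleDual E μ p q v ω : X →ₘ[μ] ℝ), coeFn_pnorm_LpSec v,
      abs_pair_le_absDual v' ω, (pnorm_le_one_iff ω).1 hω, h0, hv,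
      toModuleDual_apply v v' ω ω' hv hω'.symm] with x h1 h2 h3 h4 h5 h6 h7
    rw [h1, h2, EReal.coe_le_coe_iff, h7, ← h5, h6]
    exact ((le_abs_self _).trans h3).trans (mul_le_of_le_one_left (norm_nonneg _) h4)
  · obtain ⟨φ, hφ, hφb⟩ := exists_norming_seq B
    choose Ω hΩ using fun a : ℕ × ℕ => exists_cutoffDual (E := E) (q := q) (hφ a.1)
      (measurableSet_spanningSets μ a.2) (measure_spanningSets_lt_top μ a.2).ne
    have hΩ1 : ∀ a, ∀ᵐ x ∂μ, PointwiseNorm.pnorm (μ := μ) (Ω a) x ≤ 1 := fun a => by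
      rw [pnorm_le_one_iff]
      filter_upwards [absDual_le_norm (hΩ a)] with x hx
      exact hx.trans ((norm_cutoffDual_le (hφ _) _ x).trans (Set.indicator_le_self' (by simp) x))
    have key : ∀ᵐ x ∂μ, ∀ a : ℕ × ℕ,
        (((spanningSets μ a.2).indicator (fun _ => (1 : ℝ)) x * φ a.1 (v'.toFun x) : ℝ) : EReal) ≤
          PointwiseNorm.pnorm (μ := μ) (toModuleDual E μ p q v) x := ae_all_iff.2 fun a => by
      filter_upwards [AEEqFun.coeFn_le.2 (hlub.1 ⟨Ω a, hΩ1 a, rfl⟩),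
        coeFn_toExt (toModuleDual E μ p q v (Ω a) : X →ₘ[μ] ℝ),
        toModuleDual_apply v v' (Ω a) _ hv (hΩ a)] with x h1 h2 h3
      rw [h2, h3] at h1
      exact h1
    rw [← AEEqFun.coeFn_le]
    filter_upwards [key, coeFn_pnorm_LpSec v, hv] with x h1 h2 h3
    rw [h2, h3]
    have h4 : ∀ n, ((φ n (v'.toFun x) : ℝ) : EReal) ≤
        PointwiseNorm.pnorm (μ := μ) (toModuleDual E μ p q v) x := fun n => by
      have h5 := h1 (n, spanningSetsIndex μ x)
      rwa [Set.indicator_of_mem (mem_spanningSetsIndex μ x), one_mul] at h5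
    generalize (PointwiseNorm.pnorm (μ := μ) (toModuleDual E μ p q v)) x = r at h4
    induction r using EReal.rec with
    | bot => exact absurd (h4 0) (not_le.2 (EReal.bot_lt_coe _))
    | top => exact le_top
    | coe r => exact EReal.coe_le_coe_iff.2 (hφb _ r fun n => EReal.coe_le_coe_iff.1 (h4 n))

end Pairing

/-! ### Surjectivity of the canonical map -/

theorem coeFn_sum_zsmul {X ι : Type*} [MeasurableSpace X] {μ : Measure X}
    {p : ℝ≥0∞} (s : Finset ι) (c : ι → ℤ) (f : ι → Lp ℝ p μ) :
    ⇑(∑ i ∈ s, c i • f i) =ᵐ[μ] fun x => ∑ i ∈ s, (c i : ℝ) * f i x := by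
  classical
  induction s using Finset.induction_on with
  | empty =>
    simp only [Finset.sum_empty]
    exact Lp.coeFn_zero ℝ p μ
  | insert a s ha ih =>
    rw [Finset.sum_insert ha, ← Int.cast_smul_eq_zsmul ℝ]
    filter_upwards [ih, Lp.coeFn_add ((c a : ℝ) • f a) (∑ i ∈ s, c i • f i),
      Lp.coeFn_smul (c a : ℝ) (f a)] with x h1 h2 h3
    rw [h2, Pi.add_apply, h3, h1, Finset.sum_insert ha, Pi.smul_apply, smul_eq_mul]

section Representation

variable {X B : Type*} [MeasurableSpace X] [NormedAddCommGroup B] [NormedSpace ℝ B]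
  {E : BanachBundle X B} {μ : Measure X} [SigmaFinite μ] {p q : ℝ≥0∞} [Fact (1 ≤ q)]

/-- On a countable family, `T` is evaluation at a vector of the fiber for almost every point. The
countably many integer combinations of the family are dominated simultaneously, so the values of `T`
pose a solvable moment problem in almost every fiber. -/
theorem exists_fiberwise_eval [p.HolderConjugate q] (hp₁ : 1 < p) (hp : p < ∞)
    (hE : E.IsReflexive μ) (T : ModuleDual μ (LqDualSec E μ q)) {ι : Type*} [Countable ι]
    {η : ι → DualSec E} {Ω : ι → LqDualSec E μ q} (hΩ : ∀ i, (Ω i).1 = DualSec0.mk μ (η i)) :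
    ∃ g : Lp ℝ p μ, ∀ᵐ x ∂μ, ∃ y : E.fiber x, ‖y‖ ≤ g x ∧ ∀ i, (η i).1 x y = T (Ω i) x := by
  obtain ⟨g, hg⟩ := exists_dominating hp₁ hp T fun c : ι →₀ ℤ => ∑ i ∈ c.support, c i • Ω i
  have h1 : ∀ᵐ x ∂μ, ∀ c : ι →₀ ℤ, absDual (∑ i ∈ c.support, c i • Ω i) x ≤
      ‖∑ i ∈ c.support, c i • (η i).1 x‖ := ae_all_iff.2 fun c => by
    have h : (∑ i ∈ c.support, c i • Ω i : LqDualSec E μ q).1 =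
        DualSec0.mk μ (∑ i ∈ c.support, c i • η i) := by
      rw [map_sum, AddSubmonoidClass.coe_finsetSum]
      refine Finset.sum_congr rfl fun i _ => ?_
      rw [map_zsmul, ← hΩ]
      rfl
    filter_upwards [absDual_le_norm h] with x hx
    refine hx.trans_eq (congrArg norm ?_)
    rw [AddSubgroup.val_finsetSum, Finset.sum_apply]
    rfl
  have h2 : ∀ᵐ x ∂μ, ∀ c : ι →₀ ℤ, T (∑ i ∈ c.support, c i • Ω i) x =
      ∑ i ∈ c.support, (c i : ℝ) * T (Ω i) x := ae_all_iff.2 fun c => by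
    simp only [map_sum, map_zsmul]
    exact coeFn_sum_zsmul _ _ _
  refine ⟨g, ?_⟩
  filter_upwards [hg, h1, h2, hE] with x hg h1 h2 hV
  refine exists_eval_eq_of_reflexive hV hg.1 fun c => ?_
  rw [← h2]
  exact (hg.2 c).trans (mul_le_mul_of_nonneg_left (h1 c) hg.1)

/-- In the reflexive case, every element of the dual of `Γ_q(E'_{w*})` is given by an element of
`Γ_p(E)`. -/
theorem toModuleDual_surjective [TopologicalSpace.SeparableSpace B] [p.HolderConjugate q]
    (hp₁ : 1 < p) (hp : p < ∞) (hE : E.IsReflexive μ) :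
    Function.Surjective (toModuleDual E μ p q) := by
  intro T
  obtain ⟨φ, hφ, hφb⟩ := exists_norming_seq B
  choose Ω hΩ using fun a : ℕ × ℕ => exists_cutoffDual (E := E) (q := q) (hφ a.1)
    (measurableSet_spanningSets μ a.2) (measure_spanningSets_lt_top μ a.2).ne
  obtain ⟨g, hg⟩ := exists_fiberwise_eval hp₁ hp hE T hΩ
  obtain ⟨t, ht, htm, hty⟩ := hg.exists_measurable_mem
  choose! y hyg hy using hty
  classical
  let v : ∀ x, E.fiber x := fun x => if x ∈ t then y x else 0
  have hvt : ∀ x ∈ t, v x = y x := fun x hx => if_pos hx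
  have hvn : ∀ x, x ∉ t → v x = 0 := fun x hx => if_neg hx
  -- Only the cut-off values of `φ n ∘ v` are prescribed; `φ n ∘ v` is their pointwise limit.
  have hvm : ∀ n, Measurable fun x => φ n (v x) := fun n => by
    refine measurable_of_tendsto_metrizable (f := fun k => t.indicator (T (Ω (n, k))))
      (fun k => (Lp.stronglyMeasurable _).measurable.indicator htm)
      (tendsto_pi_nhds.2 fun x => tendsto_const_nhds.congr' ?_)
    filter_upwards [Filter.eventually_ge_atTop (spanningSetsIndex μ x)] with k hk
    by_cases hx : x ∈ t
    · rw [Set.indicator_of_mem hx, ← hy x hx (n, k), cutoffDual_apply, hvt x hx,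
        Set.indicator_of_mem (monotone_spanningSets μ hk (mem_spanningSetsIndex μ x)), one_mul]
    · rw [Set.indicator_of_notMem hx, hvn x hx, ZeroMemClass.coe_zero, map_zero]
  let v' : Sec E := ⟨v, stronglyMeasurable_of_norming hφ hφb hvm⟩
  have hvL : MemLp (fun x => (v x : B)) p μ := by
    refine (Lp.memLp g).mono v'.stronglyMeasurable.aestronglyMeasurable ?_
    filter_upwards [ht] with x hx
    rw [hvt x hx]
    exact (hyg x hx).trans (le_abs_self _)
  let u : LpSec E μ p := ⟨hvL.toLp _, v', hvL.coeFn_toLp⟩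
  refine ⟨u, ContinuousLinearMap.ext fun ω => Lp.ext ?_⟩
  obtain ⟨ω', hω⟩ := DualSec0.mk_surjective ω.1
  -- Solving the moment problem with `ω` added to the family yields the same vector `v x`, since the
  -- norming sequence separates points.
  obtain ⟨g', hg'⟩ := exists_fiberwise_eval hp₁ hp hE T (ι := Option (ℕ × ℕ))
    (η := fun o => o.elim ω' fun a => cutoffDual E (φ a.1) (measurableSet_spanningSets μ a.2))
    (Ω := fun o => o.elim ω Ω) (by
      rintro (_ | a)
      · exact hω.symm
      · exact hΩ a)
  filter_upwards [hg', ht, toModuleDual_apply (q := q) u v' ω ω' hvL.coeFn_toLp hω.symm]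
    with x hz hx hu
  obtain ⟨z, -, hz⟩ := hz
  have hzv : z = v x := by
    rw [hvt x hx, ← sub_eq_zero, ← norm_le_zero_iff]
    refine hφb _ 0 fun n => le_of_eq ?_
    have h1 := (hz (some (n, spanningSetsIndex μ x))).trans
      (hy x hx (n, spanningSetsIndex μ x)).symm
    simp only [Option.elim_some] at h1
    rw [cutoffDual_apply, cutoffDual_apply, Set.indicator_of_mem (mem_spanningSetsIndex μ x),
      one_mul, one_mul] at h1
    change φ n ((z : B) - y x) = 0
    rw [map_sub, h1, sub_self]
  have h2 : ω'.1 x z = T ω x := hz none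
  rw [hu, ← h2, hzv]

theorem toModuleDual_injective [TopologicalSpace.SeparableSpace B] [Fact (1 ≤ p)] [CompleteSpace B]
    [p.HolderConjugate q] : Function.Injective (toModuleDual E μ p q) := by
  have hM := isLpBanachModule_LpSec (E := E) (μ := μ) (p := p)
  refine (injective_iff_map_eq_zero _).2 fun v hv => (hM.eq_zero_iff v).1 ?_
  rw [← pnorm_toModuleDual (q := q), hv, ← map_zero (toModuleDual E μ p q), pnorm_toModuleDual]
  exact (hM.eq_zero_iff 0).2 rfl

end Representation

theorem proposition3p8 {X B : Type*} [MeasurableSpace X] (μ : Measure X) [SigmaFinite μ]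
    [NormedAddCommGroup B] [NormedSpace ℝ B] [CompleteSpace B]
    [TopologicalSpace.SeparableSpace B] (p q : ℝ≥0∞) [Fact (1 ≤ p)] [Fact (1 ≤ q)]
    [p.HolderConjugate q] (hp₁ : 1 < p) (hp : p < ∞) (E : BanachBundle X B)
    (hE : E.IsReflexive μ) :
    IsLpBanachModule μ p (LpSec E μ p) ∧
    IsLpBanachModule μ p (ModuleDual μ (LqDualSec E μ q)) ∧
    ∃ θ : LpSec E μ p ≃ₗ[Linf μ] ModuleDual μ (LqDualSec E μ q),
      (∀ (v : LpSec E μ p) (v' : Sec E) (ω : LqDualSec E μ q) (ω' : DualSec E),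
        (v.1 =ᵐ[μ] fun x => (v'.toFun x : B)) → ω.1 = DualSec0.mk μ ω' →
        θ v ω =ᵐ[μ] fun x => ω'.1 x (v'.toFun x)) ∧
      ∀ v : LpSec E μ p,
        PointwiseNorm.pnorm (μ := μ) (θ v) = PointwiseNorm.pnorm (μ := μ) v := by
  let θ : LpSec E μ p ≃ₗ[Linf μ] ModuleDual μ (LqDualSec E μ q) :=
    LinearEquiv.ofBijective (toModuleDual E μ p q)
      ⟨toModuleDual_injective, toModuleDual_surjective hp₁ hp hE⟩
  exact ⟨isLpBanachModule_LpSec,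
    isLpBanachModule_of_equiv isLpBanachModule_LpSec θ pnorm_toModuleDual, θ, toModuleDual_apply,
    pnorm_toModuleDual⟩
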